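/- Let $n\ge 2$ and let $T\mathbb S^{n-1}=\{(x,\xi)\in\mathbb R^n\times\mathbb R^n : |\xi|=1,\ \langle x,\xi\rangle=0\}$. For a vector field $f=(f_1,\dots,f_n)\in\mathcal S(\mathbb R^n;\mathbb C^n)$ and $k=0,1$ let $$(I^kf)(x,\xi)=\int_{-\infty}^{\infty}t^k\sum_{i=1}^n f_i(x+t\xi)\,\xi_i\,dt,\qquad (x,\xi)\in T\mathbb S^{n-1}.$$ Let $\widehat g(y)=(2\pi)^{-n/2}\int_{\mathbb R^n}e^{-i\langle y,x\rangle}g(x)\,dx$ for functions on $\mathbb R^n$ and $$\widehat\varphi(y,\xi)=(2\pi)^{-(n-1)/2}\int_{\xi^\perp}e^{-i\langle y,x\rangle}\varphi(x,\xi)\,dx,\qquad (y,\xi)\in T\mathbb S^{n-1},$$ for functions on $T\mathbb S^{n-1}$ (extended in the Plancherel sense when $\varphi(\cdot,\xi)$ is only square integrable on $\xi^\perp$). Let $\Xi_i$ ($1\le i\le n$) be the vector field on $T\mathbb S^{n-1}$ that is the restriction of $\frac{\partial}{\partial\xi^i}-\sum_p x_i\xi_p\frac{\partial}{\partial x^p}-\sum_p\xi_i\xi_p\frac{\partial}{\partial\xi^p}$.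 Let $Z$ be the pseudodifferential operator defined by $$\widehat{Z\varphi}(y,\xi)=\sum_{i=1}^n\frac{y_i}{|y|}\,(\Xi_i\widehat\varphi)(y,\xi).$$ Put $\|f\|^2_{H^s_t(\mathbb R^n;\mathbb C^n)}=\sum_{i=1}^n\int_{\mathbb R^n}|y|^{2t}(1+|y|^2)^{s-t}|\widehat f_i(y)|^2\,dy$, and $$(\varphi,\psi)_{H^s_t}=\frac1{2\pi}\int_{\mathbb S^{n-1}}\int_{\xi^\perp}|y|^{2t}(1+|y|^2)^{s-t}\,\widehat\varphi(y,\xi)\,\overline{\widehat\psi(y,\xi)}\,dy\,d\xi,\qquad \|\varphi\|^2_{H^s_t}=(\varphi,\varphi)_{H^s_t}$$ on $T\mathbb S^{n-1}$, where $d\xi$ is the surface measure of $\mathbb S^{n-1}$. **Theorem (Reshetnyak formula for vector fields).** For every $f\in\mathcal S(\mathbb R^n;\mathbb C^n)$, every $s\in\mathbb R$ and every $t>-n/2$, the functions $I^0f$ and $\widehat{I^0f}$ are differentiable on $T\mathbb S^{n-1}$, $Z(I^0f)$ satisfies the defining relation above (for every $\xi$ and almost every $y\in\xi^\perp$), all norms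 and scalar products below are given by absolutely convergent integrals, and $$\|f\|^2_{H^s_t(\mathbb R^n;\mathbb C^n)}=a_n\Big[\sum_{i=1}^n\|\Xi_i(I^0f)\|^2_{H^{s+1/2}_{t+1/2}}+\|I^0f\|^2_{H^{s+1/2}_{t+1/2}}+\|I^1f\|^2_{H^{s+3/2}_{t+3/2}}+2\,\mathrm{Re}\,\big(i\,Z(I^0f),I^1f\big)_{H^{s+1}_{t+1}}\Big],$$ where $$a_n=\frac{\Gamma\big((n-1)/2\big)}{2\pi^{(n-1)/2}}.$$ -/

import Mathlib

open MeasureTheory SchwartzMap FourierTransform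
open scoped ComplexConjugate

noncomputable section

/-- Euclidean space `ℝⁿ`. -/
abbrev Euc (n : ℕ) : Type := EuclideanSpace ℝ (Fin n)

/-- Smooth fast decaying vector fields `f ∈ 𝓢(ℝⁿ; ℂⁿ)`. -/
abbrev SchwartzField (n : ℕ) : Type := 𝓢(Euc n, EuclideanSpace ℂ (Fin n))

/-- The unit sphere `𝕊ⁿ⁻¹` of `ℝⁿ`. -/
abbrev USphere (n : ℕ) : Type := Metric.sphere (0 : Euc n) 1

/-- The hyperplane `ξ^⊥`, with the inner product and the Lebesgue measure induced from `ℝⁿ`. -/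
abbrev perp {n : ℕ} (ξ : Euc n) : Submodule ℝ (Euc n) := (ℝ ∙ ξ)ᗮ

/-- The manifold `T𝕊ⁿ⁻¹ = {(x, ξ) ∈ ℝⁿ × ℝⁿ : |ξ| = 1, ⟨x, ξ⟩ = 0}`. -/
def TS (n : ℕ) : Type := {p : Euc n × Euc n // ‖p.2‖ = 1 ∧ inner ℝ p.1 p.2 = 0}

/-- The base-point component `x` of `(x, ξ) ∈ T𝕊ⁿ⁻¹`. -/
def TS.pt {n : ℕ} (p : TS n) : Euc n := p.1.1

/-- The direction component `ξ` of `(x, ξ) ∈ T𝕊ⁿ⁻¹`, a point of the sphere. -/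
def TS.dir {n : ℕ} (p : TS n) : USphere n :=
  ⟨p.1.2, by simpa using p.2.1⟩

/-- The point `(x, ξ)` of `T𝕊ⁿ⁻¹` given by `ξ ∈ 𝕊ⁿ⁻¹` and `x ∈ ξ^⊥`. -/
def TS.mk {n : ℕ} (ξ : USphere n) (x : perp (ξ : Euc n)) : TS n :=
  ⟨((x : Euc n), (ξ : Euc n)), by
    refine ⟨by simp, ?_⟩
    rw [real_inner_comm]
    exact Submodule.mem_orthogonal_singleton_iff_inner_right.mp x.2⟩

/-- `x` seen as a vector of the hyperplane `ξ^⊥`, for `(x, ξ) ∈ T𝕊ⁿ⁻¹`. -/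
def TS.vec {n : ℕ} (p : TS n) : perp (p.dir : Euc n) :=
  ⟨p.pt, by
    rw [Submodule.mem_orthogonal_singleton_iff_inner_right, real_inner_comm]
    exact p.2.2⟩

/-- The retraction `(x, ξ) ↦ (x - (⟨ξ, x⟩ / |ξ|²) ξ, ξ / |ξ|)` of `ℝⁿ × (ℝⁿ ∖ {0})` onto
`T𝕊ⁿ⁻¹`. -/
def TS.retract {n : ℕ} (q : Euc n × Euc n) (h : q.2 ≠ 0) : TS n :=
  ⟨(q.1 - (inner ℝ q.2 q.1 / ‖q.2‖ ^ 2) • q.2, ‖q.2‖⁻¹ • q.2), by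
    have h' : ‖q.2‖ ≠ 0 := norm_ne_zero_iff.mpr h
    refine ⟨by simp [norm_smul, h'], ?_⟩
    simp only [inner_smul_right, inner_sub_left, inner_smul_left, real_inner_self_eq_norm_sq,
      RCLike.conj_to_real]
    rw [div_mul_cancel₀ _ (pow_ne_zero 2 h'), real_inner_comm, sub_self, mul_zero]⟩

open Classical in
/-- The extension `φ(x - (⟨ξ, x⟩ / |ξ|²) ξ, ξ / |ξ|)` of a function `φ` on `T𝕊ⁿ⁻¹` to
`ℝⁿ × (ℝⁿ ∖ {0})` (with the irrelevant value `0` at `ξ = 0`). -/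
def extTS {n : ℕ} (φ : TS n → ℂ) (q : Euc n × Euc n) : ℂ :=
  if h : q.2 ≠ 0 then φ (TS.retract q h) else 0

/-- `φ` is differentiable at every point of `T𝕊ⁿ⁻¹`. -/
def DifferentiableTS {n : ℕ} (φ : TS n → ℂ) : Prop :=
  ∀ p : TS n, DifferentiableAt ℝ (extTS φ) p.1

/-- The tangent vector of `T𝕊ⁿ⁻¹` at `(x, ξ)` that is the value of the vector field
`Ξᵢ = ∂/∂ξⁱ - xᵢ ξᵖ ∂/∂xᵖ - ξᵢ ξᵖ ∂/∂ξᵖ`. -/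
def xiVec {n : ℕ} (i : Fin n) (q : Euc n × Euc n) : Euc n × Euc n :=
  (-(q.1 i • q.2), EuclideanSpace.single i 1 - q.2 i • q.2)

/-- The first order differential operator `Ξᵢ` on functions on `T𝕊ⁿ⁻¹`. Since the vector field is
tangent to `T𝕊ⁿ⁻¹`, any extension of `φ` may be differentiated. -/
def opXi {n : ℕ} (i : Fin n) (φ : TS n → ℂ) (p : TS n) : ℂ :=
  fderiv ℝ (extTS φ) p.1 (xiVec i p.1)

/-- The momentum ray transform of a vector field,
`(Iᵏ f)(x, ξ) = ∫ tᵏ fᵢ(x + t ξ) ξⁱ dt`. -/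
def rayTransform {n : ℕ} (k : ℕ) (f : SchwartzField n) (p : TS n) : ℂ :=
  ∫ t : ℝ, (t : ℂ) ^ k *
    ∑ i, f (p.pt + t • (p.dir : Euc n)) i * (((p.dir : Euc n) i : ℝ) : ℂ)

/-- The Fourier transform `(2π)^{-n/2} ∫ e^{-i⟨y, x⟩} g(x) dx` on `ℝⁿ`. -/
def fourierRn {n : ℕ} (g : Euc n → ℂ) (y : Euc n) : ℂ :=
  (((2 * Real.pi) ^ (-((n : ℝ) / 2)) : ℝ) : ℂ) *
    ∫ x : Euc n, Complex.exp (-(Complex.I * ((inner ℝ y x : ℝ) : ℂ))) * g x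

/-- The restriction of a function on `T𝕊ⁿ⁻¹` to the fibre `ξ^⊥`. -/
def fibre {n : ℕ} (φ : TS n → ℂ) (ξ : USphere n) (x : perp (ξ : Euc n)) : ℂ := φ (TS.mk ξ x)

/-- The constant `(2π)^{-(n-1)/2}`. -/
def fourierConst (n : ℕ) : ℂ := (((2 * Real.pi) ^ (-(((n : ℝ) - 1) / 2)) : ℝ) : ℂ)

open Classical in
/-- The Fourier transform
`φ̂(y, ξ) = (2π)^{-(n-1)/2} ∫_{ξ^⊥} e^{-i⟨y, x⟩} φ(x, ξ) dx` in the fibres of `T𝕊ⁿ⁻¹`.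
It is given by this integral when `φ(·, ξ)` is integrable. When `φ(·, ξ)` is not integrable but
square integrable, it is the Plancherel extension of the integral, i.e. the `L²` Fourier transform
of Mathlib (with kernel `e^{-2πi⟨w, x⟩}`) at `w = y / (2π)`, multiplied by `(2π)^{-(n-1)/2}`. -/
def fourierTS {n : ℕ} (φ : TS n → ℂ) (p : TS n) : ℂ :=
  if Integrable (fibre φ p.dir) then
    fourierConst n * ∫ x : perp (p.dir : Euc n),
      Complex.exp (-(Complex.I * ((inner ℝ p.vec x : ℝ) : ℂ))) * fibre φ p.dir x
  else if h : MemLp (fibre φ p.dir) 2 then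
    fourierConst n * (𝓕 (h.toLp (fibre φ p.dir)) :
      Lp ℂ 2 (volume : Measure (perp (p.dir : Euc n)))) ((2 * Real.pi)⁻¹ • p.vec)
  else 0

/-- The inverse Fourier transform
`(2π)^{-(n-1)/2} ∫_{ξ^⊥} e^{i⟨x, y⟩} Φ(y, ξ) dy` in the fibres of `T𝕊ⁿ⁻¹`. -/
def fourierInvTS {n : ℕ} (Φ : TS n → ℂ) (p : TS n) : ℂ :=
  fourierConst n * ∫ y : perp (p.dir : Euc n),
    Complex.exp (Complex.I * ((inner ℝ p.vec y : ℝ) : ℂ)) * fibre Φ p.dir y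

/-- The function `(y, ξ) ↦ (yⁱ / |y|) (Ξᵢ φ̂)(y, ξ)` on `T𝕊ⁿ⁻¹`. -/
def zSymbol {n : ℕ} (φ : TS n → ℂ) (p : TS n) : ℂ :=
  ∑ i, ((p.pt i / ‖p.pt‖ : ℝ) : ℂ) * opXi i (fourierTS φ) p

/-- The first order pseudodifferential operator `Z`: the Fourier transform of `Zφ` is
`(yⁱ / |y|) (Ξᵢ φ̂)(y, ξ)`. -/
def opZ {n : ℕ} (φ : TS n → ℂ) : TS n → ℂ := fourierInvTS (zSymbol φ)

/-- The weight `|y|^{2t} (1 + |y|²)^{s-t}`. -/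
def weight {n : ℕ} (s t : ℝ) (y : Euc n) : ℝ := ‖y‖ ^ (2 * t) * (1 + ‖y‖ ^ 2) ^ (s - t)

/-- The square `‖g‖²_{H^s_t(ℝⁿ)}` of the norm of a scalar function. -/
def normSqRn {n : ℕ} (s t : ℝ) (g : Euc n → ℂ) : ℝ :=
  ∫ y : Euc n, weight s t y * ‖fourierRn g y‖ ^ 2

/-- The integral defining `‖g‖_{H^s_t(ℝⁿ)}` converges. -/
def FiniteNormRn {n : ℕ} (s t : ℝ) (g : Euc n → ℂ) : Prop :=
  Integrable fun y : Euc n => weight s t y * ‖fourierRn g y‖ ^ 2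

/-- The square `‖f‖²_{H^s_t(ℝⁿ; ℂⁿ)} = ∑ᵢ ‖fᵢ‖²_{H^s_t(ℝⁿ)}` of the norm of a vector field. -/
def normSqField {n : ℕ} (s t : ℝ) (f : SchwartzField n) : ℝ :=
  ∑ i, normSqRn s t (fun x => f x i)

/-- Integration over `T𝕊ⁿ⁻¹`: the iterated integral `∫_{𝕊ⁿ⁻¹} ∫_{ξ^⊥} G(y, ξ) dy dξ`, where `dξ`
is the surface measure of the sphere. -/
def integralTS {n : ℕ} (G : TS n → ℂ) : ℂ :=
  ∫ ξ : USphere n, (∫ y : perp (ξ : Euc n), G (TS.mk ξ y)) ∂(volume : Measure (Euc n)).toSphere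

/-- The iterated integral `∫_{𝕊ⁿ⁻¹} ∫_{ξ^⊥} G(y, ξ) dy dξ` converges absolutely. -/
def IntegrableTS {n : ℕ} (G : TS n → ℂ) : Prop :=
  (∀ᵐ ξ : USphere n ∂(volume : Measure (Euc n)).toSphere,
      Integrable fun y : perp (ξ : Euc n) => G (TS.mk ξ y)) ∧
    Integrable (fun ξ : USphere n => ∫ y : perp (ξ : Euc n), G (TS.mk ξ y))
      (volume : Measure (Euc n)).toSphere ∧
    Integrable (fun ξ : USphere n => ∫ y : perp (ξ : Euc n), ‖G (TS.mk ξ y)‖)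
      (volume : Measure (Euc n)).toSphere

/-- The function `|y|^{2t} (1 + |y|²)^{s-t} φ̂(y, ξ) conj ψ̂(y, ξ)` on `T𝕊ⁿ⁻¹`. -/
def innerIntegrand {n : ℕ} (s t : ℝ) (φ ψ : TS n → ℂ) (p : TS n) : ℂ :=
  ((weight s t p.pt : ℝ) : ℂ) * (fourierTS φ p * conj (fourierTS ψ p))

/-- The scalar product `(φ, ψ)_{H^s_t(T𝕊ⁿ⁻¹)}`, linear in the first argument. -/
def innerTS {n : ℕ} (s t : ℝ) (φ ψ : TS n → ℂ) : ℂ :=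
  (((2 * Real.pi)⁻¹ : ℝ) : ℂ) * integralTS (innerIntegrand s t φ ψ)

/-- The integral defining `(φ, ψ)_{H^s_t(T𝕊ⁿ⁻¹)}` converges absolutely. -/
def FiniteInnerTS {n : ℕ} (s t : ℝ) (φ ψ : TS n → ℂ) : Prop :=
  IntegrableTS (innerIntegrand s t φ ψ)

/-- The square
`‖φ‖²_{H^s_t(T𝕊ⁿ⁻¹)} = (1 / 2π) ∫_{𝕊ⁿ⁻¹} ∫_{ξ^⊥} |y|^{2t} (1 + |y|²)^{s-t} |φ̂(y, ξ)|² dy dξ`. -/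
def normSqTS {n : ℕ} (s t : ℝ) (φ : TS n → ℂ) : ℝ :=
  (2 * Real.pi)⁻¹ * ∫ ξ : USphere n, (∫ y : perp (ξ : Euc n),
    weight s t (y : Euc n) * ‖fourierTS φ (TS.mk ξ y)‖ ^ 2) ∂(volume : Measure (Euc n)).toSphere

/-- The norm `‖φ‖_{H^s_t(T𝕊ⁿ⁻¹)}` is finite (the integral defining it converges). -/
def FiniteNormTS {n : ℕ} (s t : ℝ) (φ : TS n → ℂ) : Prop :=
  FiniteInnerTS s t φ φ

/-- The constant `aₙ = Γ((n-1)/2) / (2 π^{(n-1)/2})`. -/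
def reshConst (n : ℕ) : ℝ :=
  Real.Gamma (((n : ℝ) - 1) / 2) / (2 * Real.pi ^ (((n : ℝ) - 1) / 2))

end

/-! The formula is a pointwise identity on the Fourier side, integrated over all pairs of a unit
vector ξ and a vector y of `ξ^⊥`.

By the Fourier slice theorem (`fourierTS_eq_of_fibre_eq_line`) the fibrewise transform of a family
of line integrals is √(2π) times the transform on ℝⁿ, restricted to `ξ^⊥`. With F = f̂(y), put a = ∑
ξⱼFⱼ (`symA`) and b = ∑ ξⱼ ∂_ξ f̂ⱼ(y) (`symB`). Up to the factor √(2π), I⁰f has symbol a, I¹f has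
symbol i·b, and Ξᵢ(I⁰f) has symbol vᵢ, where v = F − aξ − by (`symXi`). Applying Ξᵢ to the transform
of I⁰f gives the same vᵢ, so Z(I⁰f) has symbol z = ⟨v, y⟩/|y| (`symZ`).

Since y ⊥ ξ and v ⊥ ξ, expanding F = v + aξ + by gives |F|² = |v|² + |a|² + |y|²|b|² + 2|y| Re(z
b̄), which is `symbol_identity`. The shifts of the Sobolev indices by 1/2, 1 and 3/2 multiply the
weight by |y|, |y|² and |y|³, so the four terms add up to |y|·weight·|F|² (`symIntegrand_identity`).

It remains that ∫∫_{ξ^⊥} g(y) dy dξ = aₙ⁻¹ ∫ |y|⁻¹ g(y) dy (`sectionMeasure_eq`): the factor |y|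
cancels and the constant is the reciprocal area of the unit sphere of `ξ^⊥`. Both sides are rotation
invariant measures that agree on radial functions, and averaging characteristic functions over the
sphere shows that this determines a finite measure (`eq_of_isometry_invariant`).

On the analytic side, symbols decay rapidly and are measurable, which gives convergence for t >
−n/2. Because y/|y| may jump at 0, Z(I⁰f) need not be integrable on fibres, so its transform is
recovered almost everywhere by L² inversion (`fourierTS_fourierInv_ae`). -/

noncomputable section

set_option linter.unusedSectionVars false

/-! ### Rotation invariant measures and polar coordinates -/

section RotationInvariance

variable {V : Type*} [NormedAddCommGroup V] [InnerProductSpace ℝ V] [FiniteDimensional ℝ V]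
  [MeasurableSpace V] [BorelSpace V]

/-- The action of a linear isometry on the unit sphere. -/
def sphereMap (R : V ≃ₗᵢ[ℝ] V) (ω : Metric.sphere (0 : V) 1) : Metric.sphere (0 : V) 1 :=
  ⟨R ω, by simp⟩

@[simp] lemma coe_sphereMap (R : V ≃ₗᵢ[ℝ] V) (ω : Metric.sphere (0 : V) 1) :
    (sphereMap R ω : V) = R ω := rfl

lemma measurable_sphereMap (R : V ≃ₗᵢ[ℝ] V) : Measurable (sphereMap R) :=
  (R.continuous.measurable.comp measurable_subtype_coe).subtype_mk

-- The surface measure of a set is, up to a constant, the volume of the cone over it, and isometries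
-- commute with taking cones.
open scoped Pointwise in
lemma measurePreserving_sphereMap (R : V ≃ₗᵢ[ℝ] V) :
    MeasurePreserving (sphereMap R) (volume : Measure V).toSphere
      (volume : Measure V).toSphere := by
  refine ⟨measurable_sphereMap R, ?_⟩
  ext s hs
  rw [Measure.map_apply (measurable_sphereMap R) hs,
    Measure.toSphere_apply' _ (measurable_sphereMap R hs), Measure.toSphere_apply' _ hs]
  congr 1
  rw [← R.measurePreserving.measure_preimage_equiv (f := R.toMeasurableEquiv)
    (Set.Ioo (0 : ℝ) 1 • (Subtype.val '' s))]
  congr 1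
  ext x
  simp only [Set.mem_smul, Set.mem_image, Set.mem_preimage, LinearIsometryEquiv.coe_toMeasurableEquiv]
  constructor
  · rintro ⟨r, hr, -, ⟨ω, hω, rfl⟩, rfl⟩
    exact ⟨r, hr, _, ⟨_, hω, rfl⟩, by simp⟩
  · rintro ⟨r, hr, -, ⟨ω, hω, rfl⟩, h⟩
    refine ⟨r, hr, _, ⟨sphereMap R.symm ω, ?_, rfl⟩, ?_⟩
    · have : sphereMap R (sphereMap R.symm ω) = ω := by ext; simp
      rwa [this]
    · simp only [coe_sphereMap, ← map_smul, h, LinearIsometryEquiv.symm_apply_apply]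

lemma exists_isometry_of_norm_eq {v w : V} (h : ‖v‖ = ‖w‖) : ∃ R : V ≃ₗᵢ[ℝ] V, R v = w :=
  ⟨_, Submodule.reflection_sub h⟩

/-- The Fourier transform of the surface measure of the sphere at a vector of length `r`. -/
lemma integral_exp_inner_sphere_eq {v w : V} (h : ‖v‖ = ‖w‖) :
    ∫ ω : Metric.sphere (0 : V) 1, Complex.exp ((inner ℝ v ω : ℝ) * Complex.I)
        ∂(volume : Measure V).toSphere =
      ∫ ω : Metric.sphere (0 : V) 1, Complex.exp ((inner ℝ w ω : ℝ) * Complex.I)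
        ∂(volume : Measure V).toSphere := by
  obtain ⟨R, rfl⟩ := exists_isometry_of_norm_eq h
  conv_rhs => rw [← (measurePreserving_sphereMap R).map_eq,
    integral_map (measurable_sphereMap R).aemeasurable
      (by fun_prop : Continuous fun ω : Metric.sphere (0 : V) 1 =>
        Complex.exp ((inner ℝ (R v) (ω : V) : ℝ) * Complex.I)).aestronglyMeasurable]
  simp only [coe_sphereMap, LinearIsometryEquiv.inner_map_map]

/-- A finite isometry invariant measure is determined by the distribution of the norm. -/
theorem eq_of_isometry_invariant [Nontrivial V] {μ ν : Measure V} [IsFiniteMeasure μ]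
    [IsFiniteMeasure ν] (hμ : ∀ R : V ≃ₗᵢ[ℝ] V, μ.map R = μ) (hν : ∀ R : V ≃ₗᵢ[ℝ] V, ν.map R = ν)
    (h : μ.map (‖·‖) = ν.map (‖·‖)) : μ = ν := by
  obtain ⟨e, he⟩ : ∃ e : V, ‖e‖ = 1 := exists_norm_eq V zero_le_one
  set σ := (volume : Measure V).toSphere with hσ
  have hσ0 : σ.real Set.univ ≠ 0 := by
    rw [Measure.real, ENNReal.toReal_ne_zero]
    refine ⟨?_, measure_ne_top _ _⟩
    rw [Measure.measure_univ_ne_zero]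
    exact Measure.toSphere_ne_zero _
  -- The transform of the surface measure at any vector of length r, computed along the fixed
  -- direction e.
  set J : ℝ → ℂ := fun r => ∫ ω : Metric.sphere (0 : V) 1,
    Complex.exp ((inner ℝ (r • e) (ω : V) : ℝ) * Complex.I) ∂σ with hJ
  have hJm : StronglyMeasurable J := by
    refine StronglyMeasurable.integral_prod_right' (f := fun p : ℝ × Metric.sphere (0 : V) 1 =>
      Complex.exp ((inner ℝ (p.1 • e) (p.2 : V) : ℝ) * Complex.I)) ?_
    exact (by fun_prop : Continuous fun p : ℝ × Metric.sphere (0 : V) 1 =>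
      Complex.exp ((inner ℝ (p.1 • e) (p.2 : V) : ℝ) * Complex.I)).stronglyMeasurable
  -- The characteristic function of m is constant on spheres, so it equals its spherical average;
  -- exchanging integrals turns the average into an integral of J, which involves only the law of
  -- the norm.
  have key : ∀ (m : Measure V) [IsFiniteMeasure m], (∀ R : V ≃ₗᵢ[ℝ] V, m.map R = m) → ∀ k : V,
      (σ.real Set.univ : ℂ) * charFun m k = ∫ r, J (‖k‖ * r) ∂(m.map (‖·‖)) := by
    intro m _ hm k
    have h1 : ∀ ω : Metric.sphere (0 : V) 1, charFun m (‖k‖ • (ω : V)) = charFun m k := by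
      intro ω
      obtain ⟨R, hR⟩ := exists_isometry_of_norm_eq (v := k) (w := ‖k‖ • (ω : V))
        (by simp [norm_smul])
      rw [charFun_apply, charFun_apply, ← hR]
      conv_lhs => rw [← hm R]
      rw [integral_map R.continuous.aemeasurable (by fun_prop)]
      simp
    calc (σ.real Set.univ : ℂ) * charFun m k
        = ∫ ω : Metric.sphere (0 : V) 1, charFun m (‖k‖ • (ω : V)) ∂σ := by simp [h1]
      _ = ∫ x : V, ∫ ω : Metric.sphere (0 : V) 1,
            Complex.exp ((inner ℝ x (‖k‖ • (ω : V)) : ℝ) * Complex.I) ∂σ ∂m := by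
          simp_rw [charFun_apply]
          rw [integral_integral_swap]
          refine Integrable.of_bound (C := 1)
            (by unfold Function.uncurry; fun_prop : Continuous (Function.uncurry
              fun (ω : Metric.sphere (0 : V) 1) (x : V) =>
              Complex.exp ((inner ℝ x (‖k‖ • (ω : V)) : ℝ) * Complex.I))).aestronglyMeasurable ?_
          exact Filter.Eventually.of_forall fun p => by
            simp [Complex.norm_exp_ofReal_mul_I, Function.uncurry]
      _ = ∫ x : V, J (‖k‖ * ‖x‖) ∂m := by
          congr 1 with x
          have : ∀ ω : V, (inner ℝ x (‖k‖ • ω) : ℝ) = inner ℝ (‖k‖ • x) ω := by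
            intro ω; rw [inner_smul_left, inner_smul_right]; rfl
          simp_rw [this]
          exact integral_exp_inner_sphere_eq (by simp [norm_smul, he])
      _ = _ := by
          rw [integral_map (by fun_prop)]
          exact (hJm.comp_measurable (by fun_prop)).aestronglyMeasurable
  refine Measure.ext_of_charFun (funext fun k => ?_)
  have := (key μ hμ k).trans (h ▸ (key ν hν k).symm)
  exact mul_left_cancel₀ (by exact_mod_cast hσ0) this

/-- Polar coordinates for the integral of a radial function. -/
theorem lintegral_fun_norm [Nontrivial V] (f : ℝ → ENNReal) (hf : Measurable f) :
    ∫⁻ x : V, f ‖x‖ = (volume : Measure V).toSphere Set.univ *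
      ∫⁻ r in Set.Ioi (0 : ℝ), ENNReal.ofReal (r ^ (Module.finrank ℝ V - 1)) * f r := by
  have hms : MeasurableSet ({(0 : V)}ᶜ : Set V) := (measurableSet_singleton _).compl
  calc ∫⁻ x : V, f ‖x‖
      = ∫⁻ x : ({(0 : V)}ᶜ : Set V), f ‖x.1‖ ∂((volume : Measure V).comap (↑)) := by
        rw [lintegral_subtype_comap hms fun x => f ‖x‖, restrict_compl_singleton]
    _ = ∫⁻ x, f x.2 ∂(volume : Measure V).toSphere.prod
          (.volumeIoiPow (Module.finrank ℝ V - 1)) := by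
        rw [← (volume : Measure V).measurePreserving_homeomorphUnitSphereProd.map_eq,
          (Homeomorph.measurableEmbedding _).lintegral_map]
        simp
    _ = (volume : Measure V).toSphere Set.univ *
          ∫⁻ x : Set.Ioi (0 : ℝ), f x ∂.volumeIoiPow (Module.finrank ℝ V - 1) := by
        rw [lintegral_prod _ (by fun_prop)]
        simp [mul_comm]
    _ = _ := by
        rw [Measure.volumeIoiPow, lintegral_withDensity_eq_lintegral_mul _ (by fun_prop)
          (by fun_prop)]
        congr 1
        exact lintegral_subtype_comap measurableSet_Ioi
          fun r => ENNReal.ofReal (r ^ (Module.finrank ℝ V - 1)) * f r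

end RotationInvariance

/-! ### Integration over hyperplanes through the origin -/

section Sections

variable {n : ℕ}

/-- The isometry `ξ^⊥ → (R ξ)^⊥` induced by a linear isometry `R`. -/
def perpMap (R : Euc n ≃ₗᵢ[ℝ] Euc n) {ξ ξ' : Euc n} (h : R ξ = ξ') : perp ξ ≃ₗᵢ[ℝ] perp ξ' where
  toFun x := ⟨R x, by
    have := Submodule.mem_orthogonal_singleton_iff_inner_right.mp x.2
    rw [Submodule.mem_orthogonal_singleton_iff_inner_right, ← h, LinearIsometryEquiv.inner_map_map,
      this]⟩
  map_add' x y := by ext1; simp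
  map_smul' c x := by ext1; simp
  invFun x := ⟨R.symm x, by
    have := Submodule.mem_orthogonal_singleton_iff_inner_right.mp x.2
    rw [Submodule.mem_orthogonal_singleton_iff_inner_right, ← LinearIsometryEquiv.inner_map_map R, h]
    simpa using this⟩
  left_inv x := by simp
  right_inv x := by simp
  norm_map' x := by simp

@[simp] lemma coe_perpMap (R : Euc n ≃ₗᵢ[ℝ] Euc n) {ξ ξ' : Euc n} (h : R ξ = ξ') (x : perp ξ) :
    (perpMap R h x : Euc n) = R x := rfl

/-- The isometry `e^⊥ → ξ^⊥` given by the reflection exchanging `e` and `ξ`. -/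
def perpIso (e ξ : USphere n) : perp (e : Euc n) ≃ₗᵢ[ℝ] perp (ξ : Euc n) :=
  perpMap _ (Submodule.reflection_sub (v := (e : Euc n)) (w := (ξ : Euc n)) (by simp))

/-- The explicit formula makes the trivialization jointly measurable in (ξ, x), though it need not
be continuous at ξ = e. There the quotient 0/0 is read as 0 and the formula gives the identity. -/
lemma coe_perpIso (e ξ : USphere n) (x : perp (e : Euc n)) :
    (perpIso e ξ x : Euc n) = x - (2 * (inner ℝ ((e : Euc n) - ξ) (x : Euc n) /
      ‖(e : Euc n) - ξ‖ ^ 2)) • ((e : Euc n) - ξ) := by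
  rw [perpIso, coe_perpMap, Submodule.reflection_orthogonal_apply,
    Submodule.reflection_singleton_apply]
  simp [mul_smul, two_smul]

lemma norm_perpIso (e ξ : USphere n) (x : perp (e : Euc n)) :
    ‖(perpIso e ξ x : Euc n)‖ = ‖(x : Euc n)‖ := (perpIso e ξ).norm_map x

@[fun_prop]
lemma measurable_perpIso (e : USphere n) :
    Measurable fun p : USphere n × perp (e : Euc n) => (perpIso e p.1 p.2 : Euc n) := by
  simp_rw [coe_perpIso]
  fun_prop

/-- The surface measure of the sphere times the Lebesgue measure of `e^⊥`. -/
abbrev tsMeasure (e : USphere n) : Measure (USphere n × perp (e : Euc n)) :=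
  (volume : Measure (Euc n)).toSphere.prod volume

/-- The measure `A ↦ ∫ vol (A ∩ ξ^⊥) dξ` on `ℝⁿ`. -/
def sectionMeasure (e : USphere n) : Measure (Euc n) :=
  (tsMeasure e).map fun p => (perpIso e p.1 p.2 : Euc n)

lemma lintegral_sectionMeasure (e : USphere n) {g : Euc n → ENNReal} (hg : Measurable g) :
    ∫⁻ y, g y ∂sectionMeasure e = ∫⁻ ξ : USphere n, (∫⁻ y : perp (ξ : Euc n), g y)
      ∂(volume : Measure (Euc n)).toSphere := by
  rw [sectionMeasure, lintegral_map hg (by fun_prop), lintegral_prod _ (by fun_prop)]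
  refine lintegral_congr fun ξ => ?_
  exact (perpIso e ξ).measurePreserving.lintegral_comp (f := fun y => g y) (by fun_prop)

/-- R carries `ξ^⊥` isometrically onto `(R ξ)^⊥`, and the surface measure is invariant under ξ ↦ R
ξ. -/
lemma map_sectionMeasure (e : USphere n) (R : Euc n ≃ₗᵢ[ℝ] Euc n) :
    (sectionMeasure e).map R = sectionMeasure e := by
  refine Measure.ext_of_lintegral _ fun g hg => ?_
  have hgR : Measurable fun y => g (R y) := hg.comp R.continuous.measurable
  rw [lintegral_map hg R.continuous.measurable,
    lintegral_sectionMeasure e hgR, lintegral_sectionMeasure e hg]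
  have hm : Measurable fun ξ : USphere n => ∫⁻ y : perp (ξ : Euc n), g y := by
    have : (fun ξ : USphere n => ∫⁻ y : perp (ξ : Euc n), g y) =
        fun ξ => ∫⁻ x : perp (e : Euc n), g (perpIso e ξ x) := by
      ext ξ
      exact ((perpIso e ξ).measurePreserving.lintegral_comp (f := fun y => g y)
        (by fun_prop)).symm
    rw [this]
    exact Measurable.lintegral_prod_right' (f := fun p : USphere n × perp (e : Euc n) =>
      g (perpIso e p.1 p.2)) (by fun_prop)
  rw [← (measurePreserving_sphereMap R).lintegral_comp hm]
  refine lintegral_congr fun ξ => ?_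
  exact (perpMap R (coe_sphereMap R ξ).symm).measurePreserving.lintegral_comp
    (f := fun y => g y) (by fun_prop)

lemma finrank_perp (e : USphere n) : Module.finrank ℝ (perp (e : Euc n)) = n - 1 := by
  have h := Submodule.finrank_add_finrank_orthogonal (ℝ ∙ (e : Euc n))
  have he : (e : Euc n) ≠ 0 := fun h => by simpa [h] using e.2
  rw [finrank_span_singleton he, finrank_euclideanSpace_fin] at h
  change Module.finrank ℝ ↥(ℝ ∙ (e : Euc n))ᗮ = n - 1
  omega

lemma nontrivial_perp (hn : 2 ≤ n) (e : USphere n) : Nontrivial (perp (e : Euc n)) :=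
  Module.nontrivial_of_finrank_pos (R := ℝ) (by rw [finrank_perp]; omega)

lemma reshConst_pos (hn : 2 ≤ n) : 0 < reshConst n := by
  have hn' : (0 : ℝ) < ((n : ℝ) - 1) / 2 := by
    have : (2 : ℝ) ≤ n := by exact_mod_cast hn
    linarith
  have := Real.Gamma_pos_of_pos hn'
  unfold reshConst; positivity

/-- The area of the sphere is d times the volume of the unit ball, here with d = n − 1; the factor d
is absorbed by Γ(d/2 + 1) = (d/2) Γ(d/2). -/
lemma toSphere_perp_univ (hn : 2 ≤ n) (e : USphere n) :
    (volume : Measure (perp (e : Euc n))).toSphere Set.univ =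
      ENNReal.ofReal (reshConst n)⁻¹ := by
  have := nontrivial_perp hn e
  have hn' : (0 : ℝ) < ((n : ℝ) - 1) / 2 := by
    have : (2 : ℝ) ≤ n := by exact_mod_cast hn
    linarith
  have hc : ((n - 1 : ℕ) : ℝ) = (n : ℝ) - 1 := by push_cast [show 1 ≤ n by omega]; ring
  rw [Measure.toSphere_apply_univ, InnerProductSpace.volume_ball, finrank_perp, hc,
    Real.Gamma_add_one hn'.ne', ENNReal.ofReal_one, one_pow, one_mul, ← ENNReal.ofReal_natCast, hc,
    ← ENNReal.ofReal_mul (by linarith), reshConst]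
  congr 1
  have h1 : Real.sqrt Real.pi ^ (n - 1) = Real.pi ^ (((n : ℝ) - 1) / 2) := by
    rw [Real.sqrt_eq_rpow, ← Real.rpow_natCast, ← Real.rpow_mul Real.pi_pos.le, hc]
    congr 1; ring
  have := (Real.Gamma_pos_of_pos hn').ne'
  have h2 : (n : ℝ) - 1 ≠ 0 := by linarith
  rw [h1]
  field_simp

/-- Integration over all hyperplanes through the origin. -/
theorem sectionMeasure_eq (hn : 2 ≤ n) (e : USphere n) :
    sectionMeasure e = ENNReal.ofReal (reshConst n)⁻¹ •
      (volume : Measure (Euc n)).withDensity fun y => (ENNReal.ofReal ‖y‖)⁻¹ := by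
  have := nontrivial_perp hn e
  have : Nontrivial (Euc n) := ⟨(e : Euc n), 0, fun h => by simpa [h] using e.2⟩
  set c : ENNReal := ENNReal.ofReal (reshConst n)⁻¹
  set ν : Measure (Euc n) := c •
    (volume : Measure (Euc n)).withDensity fun y => (ENNReal.ofReal ‖y‖)⁻¹ with hν
  have hνl : ∀ g : Euc n → ENNReal, Measurable g →
      ∫⁻ y, g y ∂ν = c * ∫⁻ y, (ENNReal.ofReal ‖y‖)⁻¹ * g y := by
    intro g hg
    rw [hν, lintegral_smul_measure, lintegral_withDensity_eq_lintegral_mul _ (by fun_prop) hg]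
    rfl
  -- Polar coordinates in `ξ^⊥` give the density r^(n−2), and in ℝⁿ they give r^(n−1)·r⁻¹; the
  -- constant is the area of the unit sphere of `ξ^⊥`.
  have hradial : ∀ f : ℝ → ENNReal, Measurable f →
      ∫⁻ y, f ‖y‖ ∂sectionMeasure e = ∫⁻ y, f ‖y‖ ∂ν := by
    intro f hf
    rw [hνl _ (by fun_prop), lintegral_sectionMeasure e (g := fun y => f ‖y‖) (by fun_prop),
      lintegral_fun_norm (fun r => (ENNReal.ofReal r)⁻¹ * f r) (by fun_prop)]
    have h1 : ∀ ξ : USphere n, ∫⁻ y : perp (ξ : Euc n), f ‖(y : Euc n)‖ =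
        c * ∫⁻ r in Set.Ioi (0 : ℝ), ENNReal.ofReal (r ^ (n - 1 - 1)) * f r := by
      intro ξ
      have := nontrivial_perp hn ξ
      have h := lintegral_fun_norm (V := perp (ξ : Euc n)) f hf
      rw [toSphere_perp_univ hn, finrank_perp] at h
      exact h
    simp_rw [h1]
    rw [lintegral_const, mul_comm, mul_left_comm]
    congr 2
    refine setLIntegral_congr_fun measurableSet_Ioi fun r hr => ?_
    have hr' : (0 : ℝ) < r := hr
    rw [finrank_euclideanSpace_fin, ← mul_assoc, ← ENNReal.ofReal_inv_of_pos hr',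
      ← ENNReal.ofReal_mul (by positivity)]
    congr 2
    rw [show n - 1 = n - 1 - 1 + 1 by omega, pow_succ, Nat.add_sub_cancel]
    field_simp
  have hνR : ∀ R : Euc n ≃ₗᵢ[ℝ] Euc n, ν.map R = ν := by
    intro R
    refine Measure.ext_of_lintegral _ fun g hg => ?_
    have hgR : Measurable fun y => g (R y) := hg.comp R.continuous.measurable
    rw [lintegral_map hg R.continuous.measurable, hνl _ hgR, hνl _ hg]
    congr 1
    rw [← R.measurePreserving.lintegral_comp (f := fun y => (ENNReal.ofReal ‖y‖)⁻¹ * g y)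
      (by fun_prop)]
    simp
  -- Uniqueness is available for finite measures only, so both measures are multiplied by a radial
  -- Gaussian. Its density is positive and finite, hence can be divided out at the end.
  set w : Euc n → ENNReal := fun y => ENNReal.ofReal (Real.exp (-‖y‖ ^ 2)) with hw
  have hwm : Measurable w := by fun_prop
  have hinv : ∀ μ : Measure (Euc n), (∀ R : Euc n ≃ₗᵢ[ℝ] Euc n, μ.map R = μ) →
      ∀ R : Euc n ≃ₗᵢ[ℝ] Euc n, (μ.withDensity w).map R = μ.withDensity w := by
    intro μ hμ R
    refine Measure.ext_of_lintegral _ fun g hg => ?_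
    have hgR : Measurable fun y => g (R y) := hg.comp R.continuous.measurable
    rw [lintegral_map hg R.continuous.measurable,
      lintegral_withDensity_eq_lintegral_mul _ hwm hgR,
      lintegral_withDensity_eq_lintegral_mul _ hwm hg]
    conv_rhs => rw [← hμ R, lintegral_map (by fun_prop) R.continuous.measurable]
    simp [w]
  have hfin : ∫⁻ y, w y ∂sectionMeasure e ≠ ⊤ := by
    rw [lintegral_sectionMeasure e hwm]
    have h1 : ∀ ξ : USphere n, ∫⁻ y : perp (ξ : Euc n), w y = ∫⁻ y : perp (e : Euc n), w y := by
      intro ξ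
      rw [← (perpIso e ξ).measurePreserving.lintegral_comp (f := fun y => w y) (by fun_prop)]
      simp only [w, norm_perpIso]
    simp_rw [h1]
    rw [lintegral_const]
    refine ENNReal.mul_ne_top ?_ (measure_ne_top _ _)
    have hi : Integrable fun y : perp (e : Euc n) => Real.exp (-‖y‖ ^ 2) := by
      have := GaussianFourier.integrable_cexp_neg_mul_sq_norm_add (V := perp (e : Euc n))
        (b := 1) (by simp) 0 0
      refine this.norm.congr (Filter.Eventually.of_forall fun y => ?_)
      simp [Complex.norm_exp, ← Complex.ofReal_pow]
    exact (hi.lintegral_lt_top).ne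
  have hmain : (sectionMeasure e).withDensity w = ν.withDensity w := by
    have h1 : IsFiniteMeasure ((sectionMeasure e).withDensity w) := isFiniteMeasure_withDensity hfin
    have h2 : IsFiniteMeasure (ν.withDensity w) := by
      refine isFiniteMeasure_withDensity ?_
      rwa [← hradial (fun r => ENNReal.ofReal (Real.exp (-r ^ 2))) (by fun_prop)]
    refine eq_of_isometry_invariant (hinv _ (map_sectionMeasure e)) (hinv _ hνR) ?_
    refine Measure.ext_of_lintegral _ fun g hg => ?_
    rw [lintegral_map hg (by fun_prop), lintegral_map hg (by fun_prop),
      lintegral_withDensity_eq_lintegral_mul _ hwm (by fun_prop),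
      lintegral_withDensity_eq_lintegral_mul _ hwm (by fun_prop)]
    exact hradial (fun r => ENNReal.ofReal (Real.exp (-r ^ 2)) * g r) (by fun_prop)
  have hw0 : ∀ y, w y ≠ 0 := fun y => by simp [w, Real.exp_pos]
  rw [← withDensity_inv_same (μ := sectionMeasure e) hwm (.of_forall hw0)
      (.of_forall fun y => by simp [w]), hmain,
    withDensity_inv_same hwm (.of_forall hw0) (.of_forall fun y => by simp [w])]

end Sections

/-! ### Integrability of radial weights and of iterated integrals -/

section Integrability

variable {n : ℕ}

/-- In polar coordinates the first hypothesis is integrability at 0 and the second is integrability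
at infinity, where the integrand behaves like r^(d − 1 + a + 2b). Together they force b < 0. -/
lemma integrable_norm_rpow_mul {V : Type*} [NormedAddCommGroup V] [InnerProductSpace ℝ V]
    [FiniteDimensional ℝ V] [MeasurableSpace V] [BorelSpace V] [Nontrivial V] {a b : ℝ}
    (ha : -(Module.finrank ℝ V : ℝ) < a) (hab : a + 2 * b < -(Module.finrank ℝ V : ℝ)) :
    Integrable fun x : V => ‖x‖ ^ a * (1 + ‖x‖ ^ 2) ^ b := by
  refine (integrable_fun_norm_addHaar (volume : Measure V)
    (f := fun r => r ^ a * (1 + r ^ 2) ^ b)).mpr ?_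
  have hd : 0 < Module.finrank ℝ V := Module.finrank_pos
  set d := Module.finrank ℝ V
  have hd1 : ((d - 1 : ℕ) : ℝ) = (d : ℝ) - 1 := by push_cast [show 1 ≤ d by omega]; ring
  have hb : b < 0 := by linarith
  have hmeas : Measurable fun r : ℝ => r ^ (d - 1) • (r ^ a * (1 + r ^ 2) ^ b) := by fun_prop
  have hpow : ∀ r : ℝ, 0 < r → r ^ (d - 1) • (r ^ a * (1 + r ^ 2) ^ b) =
      r ^ ((d : ℝ) - 1 + a) * (1 + r ^ 2) ^ b := by
    intro r hr
    rw [smul_eq_mul, ← mul_assoc, ← Real.rpow_natCast, ← Real.rpow_add hr, hd1]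
  rw [← Set.Ioc_union_Ioi_eq_Ioi (zero_le_one' ℝ)]
  refine IntegrableOn.union ?_ ?_
  · have h1 : IntegrableOn (fun r : ℝ => r ^ ((d : ℝ) - 1 + a)) (Set.Ioc 0 1) := by
      rw [← intervalIntegrable_iff_integrableOn_Ioc_of_le zero_le_one]
      exact intervalIntegral.intervalIntegrable_rpow' (by linarith)
    refine h1.mono' hmeas.aestronglyMeasurable ?_
    refine (ae_restrict_iff' measurableSet_Ioc).mpr (.of_forall fun r hr => ?_)
    rw [hpow r hr.1, Real.norm_of_nonneg (by have := hr.1; positivity)]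
    refine mul_le_of_le_one_right (by have := hr.1; positivity) ?_
    exact Real.rpow_le_one_of_one_le_of_nonpos (by nlinarith [sq_nonneg r]) hb.le
  · have h1 : IntegrableOn (fun r : ℝ => r ^ ((d : ℝ) - 1 + a + 2 * b)) (Set.Ioi 1) :=
      integrableOn_Ioi_rpow_of_lt (by linarith) one_pos
    refine h1.mono' hmeas.aestronglyMeasurable ?_
    refine (ae_restrict_iff' measurableSet_Ioi).mpr (.of_forall fun r hr => ?_)
    have hr0 : (0 : ℝ) < r := zero_lt_one.trans hr
    rw [hpow r hr0, Real.norm_of_nonneg (by positivity), Real.rpow_add hr0 _ (2 * b)]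
    gcongr
    rw [Real.rpow_mul hr0.le, Real.rpow_two]
    exact Real.rpow_le_rpow_of_nonpos (by positivity) (by linarith) hb.le

lemma integrable_ts_of_norm_le (e : USphere n) {g : Euc n × Euc n → ℂ} (hg : Measurable g)
    {A : ℝ → ℝ} (hA : Integrable fun x : perp (e : Euc n) => A ‖(x : Euc n)‖)
    (hb : ∀ y ξ : Euc n, ‖ξ‖ = 1 → ‖g (y, ξ)‖ ≤ A ‖y‖) :
    Integrable (fun p : USphere n × perp (e : Euc n) =>
      g ((perpIso e p.1 p.2 : Euc n), (p.1 : Euc n))) (tsMeasure e) := by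
  refine (hA.comp_snd (volume : Measure (Euc n)).toSphere).mono'
    (by fun_prop : Measurable _).aestronglyMeasurable (.of_forall fun p => ?_)
  have := hb (perpIso e p.1 p.2) p.1 (by simp)
  rwa [norm_perpIso] at this

lemma integral_perp_eq {F : Type*} [NormedAddCommGroup F] [NormedSpace ℝ F] (e ξ : USphere n)
    (G : perp (ξ : Euc n) → F) : ∫ y, G y = ∫ x, G (perpIso e ξ x) :=
  ((perpIso e ξ).measurePreserving.integral_comp
    (perpIso e ξ).toHomeomorph.measurableEmbedding G).symm

lemma integrable_perp_iff {F : Type*} [NormedAddCommGroup F] (e ξ : USphere n)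
    (G : perp (ξ : Euc n) → F) : Integrable (fun x => G (perpIso e ξ x)) ↔ Integrable G :=
  (perpIso e ξ).measurePreserving.integrable_comp_emb
    (perpIso e ξ).toHomeomorph.measurableEmbedding

lemma integrableTS_of_integrable (e : USphere n) {G : TS n → ℂ}
    (h : Integrable (fun p : USphere n × perp (e : Euc n) => G (TS.mk p.1 (perpIso e p.1 p.2)))
      (tsMeasure e)) : IntegrableTS G := by
  refine ⟨?_, ?_, ?_⟩
  · filter_upwards [h.prod_right_ae] with ξ hξ
    exact (integrable_perp_iff e ξ fun y => G (TS.mk ξ y)).mp hξ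
  · simp_rw [fun ξ : USphere n => integral_perp_eq e ξ fun y => G (TS.mk ξ y)]
    exact h.integral_prod_left
  · simp_rw [fun ξ : USphere n => integral_perp_eq e ξ fun y => ‖G (TS.mk ξ y)‖]
    exact h.integral_norm_prod_left

lemma iterated_integral_eq (e : USphere n) {F : Type*} [NormedAddCommGroup F] [NormedSpace ℝ F]
    {G : TS n → F}
    (h : Integrable (fun p : USphere n × perp (e : Euc n) => G (TS.mk p.1 (perpIso e p.1 p.2)))
      (tsMeasure e)) :
    ∫ ξ : USphere n, (∫ y : perp (ξ : Euc n), G (TS.mk ξ y)) ∂(volume : Measure (Euc n)).toSphere =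
      ∫ p, G (TS.mk p.1 (perpIso e p.1 p.2)) ∂tsMeasure e := by
  rw [integral_prod _ h]
  exact integral_congr_ae (.of_forall fun ξ => integral_perp_eq e ξ fun y => G (TS.mk ξ y))

lemma IntegrableTS.congr {G G' : TS n → ℂ} (h : IntegrableTS G)
    (hG : ∀ ξ : USphere n, ∀ᵐ y : perp (ξ : Euc n), G (TS.mk ξ y) = G' (TS.mk ξ y)) :
    IntegrableTS G' := by
  obtain ⟨h1, h2, h3⟩ := h
  refine ⟨?_, ?_, ?_⟩
  · filter_upwards [h1] with ξ hξ using hξ.congr (hG ξ)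
  · exact h2.congr (.of_forall fun ξ => integral_congr_ae (hG ξ))
  · exact h3.congr (.of_forall fun ξ => integral_congr_ae
      ((hG ξ).mono fun y hy => by simp only [hy]))

lemma integralTS_congr {G G' : TS n → ℂ}
    (hG : ∀ ξ : USphere n, ∀ᵐ y : perp (ξ : Euc n), G (TS.mk ξ y) = G' (TS.mk ξ y)) :
    integralTS G = integralTS G' :=
  integral_congr_ae (.of_forall fun ξ => integral_congr_ae (hG ξ))

/-- The integral over `T𝕊ⁿ⁻¹` of a function of the base point. -/
theorem integral_tsMeasure_eq (hn : 2 ≤ n) (e : USphere n) {g : Euc n → ℝ} (hg : Measurable g) :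
    ∫ p, g (perpIso e p.1 p.2) ∂tsMeasure e = (reshConst n)⁻¹ * ∫ y, ‖y‖⁻¹ * g y := by
  have : Nontrivial (Euc n) := ⟨(e : Euc n), 0, fun h => by simpa [h] using e.2⟩
  have hc : 0 ≤ (reshConst n)⁻¹ := (inv_pos.mpr (reshConst_pos hn)).le
  have h := integral_map (μ := tsMeasure e) (measurable_perpIso e).aemeasurable
    (f := g) hg.aestronglyMeasurable
  rw [← h, ← sectionMeasure, sectionMeasure_eq hn, integral_smul_measure,
    integral_withDensity_eq_integral_toReal_smul (by fun_prop), ENNReal.toReal_ofReal hc]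
  · simp
  · have : ∀ᵐ y : Euc n, y ≠ 0 := by simp [ae_iff]
    filter_upwards [this] with y hy
    simpa using hy

end Integrability

/-! ### Rapidly decaying symbols -/

section Decay

variable {n : ℕ}

/-- Decay of `g (y, ξ)` in `y` faster than any power, uniformly in the unit vector `ξ`. -/
def RapidDecay (g : Euc n × Euc n → ℂ) : Prop :=
  ∀ k : ℕ, ∃ C : ℝ, ∀ y ξ : Euc n, ‖ξ‖ = 1 → ‖g (y, ξ)‖ * (1 + ‖y‖ ^ 2) ^ k ≤ C

lemma RapidDecay.of_schwartz (u : 𝓢(Euc n, ℂ)) : RapidDecay fun q => u q.1 := by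
  intro k
  refine ⟨2 ^ (2 * k) * ((Finset.Iic (2 * k, 0)).sup fun m => SchwartzMap.seminorm ℝ m.1 m.2) u,
    fun y ξ _ => ?_⟩
  have h := SchwartzMap.one_add_le_sup_seminorm_apply (𝕜 := ℝ) (m := (2 * k, 0)) le_rfl le_rfl u y
  rw [norm_iteratedFDeriv_zero] at h
  refine le_trans ?_ h
  rw [mul_comm, pow_mul]
  gcongr
  nlinarith [norm_nonneg y]

lemma RapidDecay.add {g h : Euc n × Euc n → ℂ} (hg : RapidDecay g) (hh : RapidDecay h) :
    RapidDecay fun q => g q + h q := by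
  intro k
  obtain ⟨C, hC⟩ := hg k
  obtain ⟨D, hD⟩ := hh k
  refine ⟨C + D, fun y ξ hξ => ?_⟩
  calc ‖g (y, ξ) + h (y, ξ)‖ * (1 + ‖y‖ ^ 2) ^ k
      ≤ (‖g (y, ξ)‖ + ‖h (y, ξ)‖) * (1 + ‖y‖ ^ 2) ^ k := by gcongr; exact norm_add_le _ _
    _ ≤ C + D := by rw [add_mul]; exact add_le_add (hC y ξ hξ) (hD y ξ hξ)

/-- A factor of growth 1 + |y|² is paid for by the decay estimate of order k + 1. -/
lemma RapidDecay.mul_of_le {g h : Euc n × Euc n → ℂ} (hg : RapidDecay g)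
    (hh : ∀ y ξ : Euc n, ‖ξ‖ = 1 → ‖h (y, ξ)‖ ≤ 1 + ‖y‖ ^ 2) :
    RapidDecay fun q => h q * g q := by
  intro k
  obtain ⟨C, hC⟩ := hg (k + 1)
  refine ⟨C, fun y ξ hξ => le_trans ?_ (hC y ξ hξ)⟩
  have h1 := mul_le_mul_of_nonneg_right (hh y ξ hξ)
    (by positivity : 0 ≤ ‖g (y, ξ)‖ * (1 + ‖y‖ ^ 2) ^ k)
  rw [norm_mul, pow_succ _ k]
  linarith

lemma RapidDecay.const_mul {g : Euc n × Euc n → ℂ} (hg : RapidDecay g) (c : ℂ) :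
    RapidDecay fun q => c * g q := by
  intro k
  obtain ⟨C, hC⟩ := hg k
  refine ⟨‖c‖ * C, fun y ξ hξ => ?_⟩
  rw [norm_mul, mul_assoc]
  exact mul_le_mul_of_nonneg_left (hC y ξ hξ) (norm_nonneg c)

lemma RapidDecay.sub {g h : Euc n × Euc n → ℂ} (hg : RapidDecay g) (hh : RapidDecay h) :
    RapidDecay fun q => g q - h q := by
  simpa [sub_eq_add_neg] using hg.add (hh.const_mul (-1))

lemma RapidDecay.sum {ι : Type*} (s : Finset ι) {g : ι → Euc n × Euc n → ℂ}
    (hg : ∀ i ∈ s, RapidDecay (g i)) : RapidDecay fun q => ∑ i ∈ s, g i q := by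
  classical
  induction s using Finset.induction_on with
  | empty => exact fun k => ⟨0, by simp⟩
  | insert i s his ih =>
    simp_rw [Finset.sum_insert his]
    exact (hg i (by simp)).add (ih fun j hj => hg j (by simp [hj]))

lemma abs_coord_le (y : Euc n) (i : Fin n) : |y i| ≤ ‖y‖ := by
  simpa using PiLp.norm_apply_le y i

lemma RapidDecay.dir_mul {g : Euc n × Euc n → ℂ} (hg : RapidDecay g) (i : Fin n) :
    RapidDecay fun q => ((q.2 i : ℝ) : ℂ) * g q := by
  refine hg.mul_of_le fun y ξ hξ => ?_
  have := abs_coord_le ξ i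
  rw [hξ] at this
  simp only [Complex.norm_real, Real.norm_eq_abs]
  nlinarith [sq_nonneg ‖y‖]

lemma RapidDecay.pt_mul {g : Euc n × Euc n → ℂ} (hg : RapidDecay g) (i : Fin n) :
    RapidDecay fun q => ((q.1 i : ℝ) : ℂ) * g q := by
  refine hg.mul_of_le fun y ξ _ => ?_
  have := abs_coord_le y i
  simp only [Complex.norm_real, Real.norm_eq_abs]
  nlinarith [sq_nonneg (‖y‖ - 1), norm_nonneg y]

lemma RapidDecay.unit_mul {g : Euc n × Euc n → ℂ} (hg : RapidDecay g) (i : Fin n) :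
    RapidDecay fun q => ((q.1 i / ‖q.1‖ : ℝ) : ℂ) * g q := by
  refine hg.mul_of_le fun y ξ _ => ?_
  have := abs_coord_le y i
  simp only [Complex.norm_real, Real.norm_eq_abs, abs_div, abs_norm]
  have := div_le_one_of_le₀ this (norm_nonneg y)
  nlinarith [sq_nonneg ‖y‖]

lemma RapidDecay.norm_le {g : Euc n × Euc n → ℂ} (hg : RapidDecay g) (k : ℕ) :
    ∃ C : ℝ, ∀ y ξ : Euc n, ‖ξ‖ = 1 → ‖g (y, ξ)‖ ≤ C * (1 + ‖y‖ ^ 2) ^ (-(k : ℝ)) := by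
  obtain ⟨C, hC⟩ := hg k
  refine ⟨C, fun y ξ hξ => ?_⟩
  rw [Real.rpow_neg (by positivity), Real.rpow_natCast, ← div_eq_mul_inv, le_div_iff₀ (by positivity)]
  exact hC y ξ hξ

lemma weight_nonneg (s t : ℝ) (y : Euc n) : 0 ≤ weight s t y := by
  unfold weight; positivity

@[fun_prop]
lemma measurable_weight (s t : ℝ) : Measurable (weight s t : Euc n → ℝ) := by
  unfold weight; fun_prop

/-- Weighted products of rapidly decaying functions are bounded by integrable radial functions. -/
lemma exists_weight_mul_le {g h : Euc n × Euc n → ℂ} (hg : RapidDecay g) (hh : RapidDecay h)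
    (s t d : ℝ) : ∃ C b : ℝ, 2 * t + 2 * b < -d ∧ ∀ y ξ : Euc n, ‖ξ‖ = 1 →
      ‖((weight s t y : ℝ) : ℂ) * (g (y, ξ) * conj (h (y, ξ)))‖ ≤
        C * (‖y‖ ^ (2 * t) * (1 + ‖y‖ ^ 2) ^ b) := by
  -- With b = s − t − k the requirement 2t + 2b < −d reads k > s + d/2. All the decay is taken from
  -- g; h is merely bounded.
  obtain ⟨k, hk⟩ := exists_nat_gt (s + d / 2)
  obtain ⟨C, hC⟩ := hg.norm_le k
  obtain ⟨D, hD⟩ := hh.norm_le 0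
  refine ⟨C * D, s - t - k, by linarith, fun y ξ hξ => ?_⟩
  have h1 := hC y ξ hξ
  have h2 : ‖h (y, ξ)‖ ≤ D := by simpa using hD y ξ hξ
  have hpos : (0 : ℝ) < 1 + ‖y‖ ^ 2 := by positivity
  rw [norm_mul, norm_mul, RCLike.norm_conj, Complex.norm_real,
    Real.norm_of_nonneg (weight_nonneg s t y)]
  calc weight s t y * (‖g (y, ξ)‖ * ‖h (y, ξ)‖)
      ≤ weight s t y * ((C * (1 + ‖y‖ ^ 2) ^ (-(k : ℝ))) * D) := by
        refine mul_le_mul_of_nonneg_left ?_ (weight_nonneg s t y)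
        exact mul_le_mul h1 h2 (norm_nonneg _) ((norm_nonneg _).trans h1)
    _ = _ := by
        rw [weight, show s - t - (k : ℝ) = (s - t) + (-(k : ℝ)) by ring, Real.rpow_add hpos]
        ring

lemma integrable_weight_mul (hn : 2 ≤ n) (e : USphere n) {g h : Euc n × Euc n → ℂ}
    (hgm : Measurable g) (hhm : Measurable h) (hg : RapidDecay g) (hh : RapidDecay h) (s : ℝ)
    {t : ℝ} (ht : -((n : ℝ) - 1) < 2 * t) :
    Integrable (fun p : USphere n × perp (e : Euc n) =>
      ((weight s t (perpIso e p.1 p.2 : Euc n) : ℝ) : ℂ) *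
        (g ((perpIso e p.1 p.2 : Euc n), (p.1 : Euc n)) *
          conj (h ((perpIso e p.1 p.2 : Euc n), (p.1 : Euc n))))) (tsMeasure e) := by
  have := nontrivial_perp hn e
  have hc : ((n - 1 : ℕ) : ℝ) = (n : ℝ) - 1 := by push_cast [show 1 ≤ n by omega]; ring
  obtain ⟨C, b, hb, hle⟩ := exists_weight_mul_le hg hh s t ((n : ℝ) - 1)
  refine integrable_ts_of_norm_le e (g := fun q => ((weight s t q.1 : ℝ) : ℂ) * (g q * conj (h q)))
    ?_ (A := fun r => C * (r ^ (2 * t) * (1 + r ^ 2) ^ b)) ?_ hle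
  · have : Measurable fun q => conj (h q) := Complex.continuous_conj.measurable.comp hhm
    fun_prop
  · refine (integrable_norm_rpow_mul (V := perp (e : Euc n)) ?_ ?_).const_mul C
    · rw [finrank_perp, hc]; exact ht
    · rw [finrank_perp, hc]; exact hb

lemma integrable_weight_mul_Rn (hn : 2 ≤ n) (u : 𝓢(Euc n, ℂ)) (s : ℝ) {t : ℝ}
    (ht : -((n : ℝ) / 2) < t) :
    Integrable fun y : Euc n => weight s t y * ‖u y‖ ^ 2 := by
  have : NeZero n := ⟨by omega⟩
  have : Nontrivial (Euc n) := Module.nontrivial_of_finrank_pos (R := ℝ) (by simp; omega)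
  obtain ⟨ξ, hξ⟩ := exists_norm_eq (Euc n) zero_le_one
  obtain ⟨C, b, hb, hle⟩ := exists_weight_mul_le (.of_schwartz u) (.of_schwartz u) s t n
  refine Integrable.mono' ((integrable_norm_rpow_mul (V := Euc n) (a := 2 * t) (b := b) ?_
    ?_).const_mul C) (by have := u.continuous; fun_prop : Measurable _).aestronglyMeasurable
    (.of_forall fun y => ?_)
  · rw [finrank_euclideanSpace_fin]; linarith
  · rwa [finrank_euclideanSpace_fin]
  · have := hle y ξ hξ
    simpa [pow_two] using this

end Decay

/-! ### The Fourier slice theorem -/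

section Slices

variable {n : ℕ}

/-- The coordinates `(t, x) ↦ x + t ξ` of `ℝⁿ` given by the decomposition `ℝ ξ ⊕ ξ^⊥`. -/
def lineCoord (ξ : USphere n) : ℝ × perp (ξ : Euc n) ≃ᵐ Euc n :=
  ((LinearIsometryEquiv.toSpanUnitSingleton (𝕜 := ℝ) (ξ : Euc n)
      (by simp)).toMeasurableEquiv.prodCongr (MeasurableEquiv.refl _)).trans
    ((MeasurableEquiv.toLp 2 _).trans
      (ℝ ∙ (ξ : Euc n)).orthogonalDecomposition.symm.toMeasurableEquiv)

lemma lineCoord_apply (ξ : USphere n) (q : ℝ × perp (ξ : Euc n)) :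
    lineCoord ξ q = (q.2 : Euc n) + q.1 • (ξ : Euc n) := by
  simp [lineCoord, MeasurableEquiv.prodCongr, add_comm]

lemma measurePreserving_lineCoord (ξ : USphere n) : MeasurePreserving (lineCoord ξ) := by
  refine MeasurePreserving.trans (β := (ℝ ∙ (ξ : Euc n)) × (ℝ ∙ (ξ : Euc n))ᗮ) ?_
    (MeasurePreserving.trans (WithLp.volume_preserving_symm_measurableEquiv_toLp_prod
        (ℝ ∙ (ξ : Euc n)) (ℝ ∙ (ξ : Euc n))ᗮ).symm
      (LinearIsometryEquiv.measurePreserving _))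
  exact (LinearIsometryEquiv.measurePreserving (LinearIsometryEquiv.toSpanUnitSingleton (𝕜 := ℝ)
    (ξ : Euc n) (by simp))).prod (.id (volume : Measure (perp (ξ : Euc n))))

variable {F : Type*} [NormedAddCommGroup F] [NormedSpace ℝ F]

lemma integrable_line (ξ : USphere n) {h : Euc n → F} (hh : Integrable h) :
    Integrable fun x : perp (ξ : Euc n) => ∫ t : ℝ, h ((x : Euc n) + t • (ξ : Euc n)) := by
  have := ((measurePreserving_lineCoord ξ).integrable_comp_emb
    (lineCoord ξ).measurableEmbedding).mpr hh
  simpa only [Function.comp_def, lineCoord_apply] using this.integral_prod_right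

lemma integral_line (ξ : USphere n) {h : Euc n → F} (hh : Integrable h) :
    ∫ x : perp (ξ : Euc n), ∫ t : ℝ, h ((x : Euc n) + t • (ξ : Euc n)) = ∫ z, h z := by
  have := ((measurePreserving_lineCoord ξ).integrable_comp_emb
    (lineCoord ξ).measurableEmbedding).mpr hh
  rw [← (measurePreserving_lineCoord ξ).integral_comp (lineCoord ξ).measurableEmbedding,
    Measure.volume_eq_prod]
  refine Eq.trans ?_ (integral_prod_symm (fun q => h (lineCoord ξ q)) this).symm
  simp only [lineCoord_apply]

/-- Fibres have one dimension less than ℝⁿ. The resulting √(2π) appears in every symbol and cancels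
against the 1/(2π) in the scalar product. -/
lemma sqrt_two_pi_mul (n : ℕ) : (Real.sqrt (2 * Real.pi) : ℂ) *
    (((2 * Real.pi) ^ (-((n : ℝ) / 2)) : ℝ) : ℂ) = fourierConst n := by
  rw [fourierConst, ← Complex.ofReal_mul, Real.sqrt_eq_rpow, ← Real.rpow_add (by positivity)]
  congr 2; ring

open Classical in
lemma fourierTS_mk (φ : TS n → ℂ) (ξ : USphere n) (y : perp (ξ : Euc n)) :
    fourierTS φ (TS.mk ξ y) = if Integrable (fibre φ ξ) then
      fourierConst n * ∫ x : perp (ξ : Euc n),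
        Complex.exp (-(Complex.I * ((inner ℝ y x : ℝ) : ℂ))) * fibre φ ξ x
    else if h : MemLp (fibre φ ξ) 2 then
      fourierConst n * (𝓕 (h.toLp (fibre φ ξ)) :
        Lp ℂ 2 (volume : Measure (perp (ξ : Euc n)))) ((2 * Real.pi)⁻¹ • y)
    else 0 := rfl

/-- The Fourier slice theorem on the fibre over `ξ`. -/
theorem fourierTS_eq_of_fibre_eq_line {φ : TS n → ℂ} {ξ : USphere n} {h : Euc n → ℂ}
    (hh : Integrable h)
    (hφ : ∀ x : perp (ξ : Euc n), φ (TS.mk ξ x) = ∫ t : ℝ, h ((x : Euc n) + t • (ξ : Euc n)))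
    (y : perp (ξ : Euc n)) :
    fourierTS φ (TS.mk ξ y) = (Real.sqrt (2 * Real.pi) : ℂ) * fourierRn h y := by
  have hf : fibre φ ξ = fun x : perp (ξ : Euc n) => ∫ t : ℝ, h ((x : Euc n) + t • (ξ : Euc n)) :=
    funext hφ
  have hi : Integrable (fibre φ ξ) := hf ▸ integrable_line ξ hh
  have hE : Integrable fun z : Euc n =>
      Complex.exp (-(Complex.I * ((inner ℝ (y : Euc n) z : ℝ) : ℂ))) * h z := by
    refine hh.bdd_mul (c := 1) (by fun_prop : Continuous _).aestronglyMeasurable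
      (.of_forall fun z => ?_)
    simp [Complex.norm_exp]
  rw [fourierTS_mk, if_pos hi, fourierRn, ← mul_assoc, sqrt_two_pi_mul, ← integral_line ξ hE]
  congr 2 with x
  change Complex.exp (-(Complex.I * ((inner ℝ (y : Euc n) (x : Euc n) : ℝ) : ℂ))) * fibre φ ξ x = _
  rw [hf, ← integral_const_mul]
  congr 1 with t
  -- As y ⊥ ξ, the exponential is constant along each line x + ℝξ and can be moved inside the line
  -- integral.
  have : inner ℝ (y : Euc n) (ξ : Euc n) = 0 := by
    rw [real_inner_comm]; exact Submodule.mem_orthogonal_singleton_iff_inner_right.mp y.2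
  rw [inner_add_right, inner_smul_right, this, mul_zero, add_zero]

end Slices

/-! ### The normalized Fourier transform of Schwartz functions -/

section SchwartzFourier

variable {n : ℕ}

open LineDeriv

/-- The homothety with factor `(2π)⁻¹`. -/
def scaleEquiv (V : Type*) [NormedAddCommGroup V] [NormedSpace ℝ V] : V ≃L[ℝ] V :=
  ContinuousLinearEquiv.smulLeft (Units.mk0 ((2 * Real.pi)⁻¹ : ℝ) (by positivity))

@[simp] lemma scaleEquiv_apply {V : Type*} [NormedAddCommGroup V] [NormedSpace ℝ V] (y : V) :
    scaleEquiv V y = (2 * Real.pi)⁻¹ • y := rfl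

/-- The Fourier transform with kernel `(2π)^{-n/2} e^{-i⟨y, x⟩}` on Schwartz functions. -/
def schwartzFT (u : 𝓢(Euc n, ℂ)) : 𝓢(Euc n, ℂ) :=
  (((2 * Real.pi) ^ (-((n : ℝ) / 2)) : ℝ) : ℂ) •
    compCLMOfContinuousLinearEquiv ℂ (scaleEquiv (Euc n)) (𝓕 u)

lemma fourier_scale {V : Type*} [NormedAddCommGroup V] [InnerProductSpace ℝ V]
    [FiniteDimensional ℝ V] [MeasurableSpace V] [BorelSpace V] (g : V → ℂ) (y : V) :
    𝓕 g ((2 * Real.pi)⁻¹ • y) =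
      ∫ x : V, Complex.exp (-(Complex.I * ((inner ℝ y x : ℝ) : ℂ))) * g x := by
  rw [Real.fourier_eq']
  congr 1 with x
  rw [smul_eq_mul, inner_smul_right, real_inner_comm]
  congr 2
  push_cast
  field_simp

lemma schwartzFT_apply (u : 𝓢(Euc n, ℂ)) (y : Euc n) : schwartzFT u y = fourierRn u y := by
  rw [fourierRn, ← fourier_scale]
  simp [schwartzFT, fourier_coe]

lemma schwartzFT_lineDeriv (u : 𝓢(Euc n, ℂ)) (m y : Euc n) :
    schwartzFT (∂_{m} u) y = Complex.I * (inner ℝ y m : ℝ) * schwartzFT u y := by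
  have : (inner ℝ · m : Euc n → ℝ).HasTemperateGrowth := by fun_prop
  simp only [schwartzFT, fourier_lineDerivOp_eq, smul_apply, compCLMOfContinuousLinearEquiv_apply,
    Function.comp_apply, scaleEquiv_apply, smulLeftCLM_apply_apply this, inner_smul_left]
  simp
  field_simp

/-- Multiplication by the linear function `⟨·, m⟩` on Schwartz functions. -/
def innerMul (m : Euc n) (u : 𝓢(Euc n, ℂ)) : 𝓢(Euc n, ℂ) := smulLeftCLM ℂ (inner ℝ · m) u

@[simp] lemma innerMul_apply (m : Euc n) (u : 𝓢(Euc n, ℂ)) (x : Euc n) :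
    innerMul m u x = (inner ℝ x m : ℝ) * u x := by
  have : (inner ℝ · m : Euc n → ℝ).HasTemperateGrowth := by fun_prop
  simp [innerMul, smulLeftCLM_apply_apply this]

lemma schwartzFT_innerMul (u : 𝓢(Euc n, ℂ)) (m y : Euc n) :
    schwartzFT (innerMul m u) y = Complex.I * fderiv ℝ (schwartzFT u) y m := by
  rw [← lineDerivOp_apply_eq_fderiv]
  have h := lineDerivOp_fourier_eq u m
  have h2 : ∂_{m} (schwartzFT u) = (((2 * Real.pi) ^ (-((n : ℝ) / 2)) : ℝ) : ℂ) •
      compCLMOfContinuousLinearEquiv ℂ (scaleEquiv (Euc n))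
        (∂_{scaleEquiv (Euc n) m} (𝓕 u)) := by
    rw [schwartzFT, lineDerivOp_smul, lineDerivOp_compCLMOfContinuousLinearEquiv]
  rw [h2, scaleEquiv_apply, lineDerivOp_left_smul, h, ← innerMul]
  simp [schwartzFT, FourierTransform.fourier_smul]
  field_simp
  simp

lemma schwartzFT_add (u v : 𝓢(Euc n, ℂ)) : schwartzFT (u + v) = schwartzFT u + schwartzFT v := by
  simp [schwartzFT]

lemma schwartzFT_smul (c : ℂ) (u : 𝓢(Euc n, ℂ)) : schwartzFT (c • u) = c • schwartzFT u := by
  simp [schwartzFT, FourierTransform.fourier_smul, smul_comm c]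

end SchwartzFourier

/-! ### Integral and L² Fourier transforms on L¹ ∩ L² -/

section Plancherel

variable {V : Type*} [NormedAddCommGroup V] [InnerProductSpace ℝ V] [FiniteDimensional ℝ V]
  [MeasurableSpace V] [BorelSpace V]

lemma continuous_fourier_of_integrable {G : V → ℂ} (hi : Integrable G) : Continuous (𝓕 G) :=
  VectorFourier.fourierIntegral_continuous Real.continuous_fourierChar
    (L := innerₗ V) continuous_inner hi

lemma continuous_fourierInv_of_integrable {G : V → ℂ} (hi : Integrable G) :
    Continuous (𝓕⁻ G) := by
  have : 𝓕⁻ G = fun x => 𝓕 G (-x) := funext fun x => Real.fourierInv_eq_fourier_neg G x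
  rw [this]
  exact (continuous_fourier_of_integrable hi).comp continuous_neg

/-- An `L²` function is determined as a distribution. -/
lemma ae_eq_of_forall_schwartz {U : Lp ℂ 2 (volume : Measure V)} {u : V → ℂ} (hu : Continuous u)
    (h : ∀ g : 𝓢(V, ℂ), ∫ x, g x • U x = ∫ x, g x • u x) : (U : V → ℂ) =ᵐ[volume] u := by
  refine ae_eq_of_integral_contDiff_smul_eq ((Lp.memLp U).locallyIntegrable (by norm_num))
    hu.locallyIntegrable fun g hg hc => ?_
  have hc' : HasCompactSupport (fun x => (g x : ℂ)) := hc.comp_left Complex.ofReal_zero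
  have := h (hc'.toSchwartzMap (Complex.ofRealCLM.contDiff.comp hg))
  simp only [Complex.real_smul]
  exact this

/-- The `L²` Fourier transform of an integrable function is given by the integral. -/
theorem coeFn_fourier_toLp {G : V → ℂ} (hi : Integrable G) (h2 : MemLp G 2) :
    (𝓕 (h2.toLp G) : Lp ℂ 2 (volume : Measure V)) =ᵐ[volume] 𝓕 G := by
  refine ae_eq_of_forall_schwartz (continuous_fourier_of_integrable hi) fun g => ?_
  -- Both transforms are tested against a Schwartz function; duality moves the transform onto the
  -- test function, where the two definitions agree.
  rw [← Lp.toTemperedDistribution_apply, ← Lp.fourier_toTemperedDistribution_eq,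
    TemperedDistribution.fourier_apply, Lp.toTemperedDistribution_apply]
  calc ∫ x, (𝓕 g) x • h2.toLp G x = ∫ x, (𝓕 g) x • G x :=
        integral_congr_ae (h2.coeFn_toLp.mono fun x hx => by simp only [hx])
    _ = ∫ x, g x • 𝓕 G x := by
        simpa using! VectorFourier.integral_fourierIntegral_smul_eq_flip (L := innerₗ V)
          Real.continuous_fourierChar continuous_inner g.integrable hi

/-- The inverse `L²` Fourier transform of an integrable function is given by the integral. -/
theorem coeFn_fourierInv_toLp {G : V → ℂ} (hi : Integrable G) (h2 : MemLp G 2) :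
    (𝓕⁻ (h2.toLp G) : Lp ℂ 2 (volume : Measure V)) =ᵐ[volume] 𝓕⁻ G := by
  refine ae_eq_of_forall_schwartz (continuous_fourierInv_of_integrable hi) fun g => ?_
  rw [← Lp.toTemperedDistribution_apply, ← Lp.fourierInv_toTemperedDistribution_eq,
    TemperedDistribution.fourierInv_apply, Lp.toTemperedDistribution_apply]
  calc ∫ x, (𝓕⁻ g) x • h2.toLp G x = ∫ x, (𝓕⁻ g) x • G x :=
        integral_congr_ae (h2.coeFn_toLp.mono fun x hx => by simp only [hx])
    _ = ∫ x, (𝓕⁻ (g : V → ℂ)) x • G x := by rw [fourierInv_coe]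
    _ = ∫ x, g x • 𝓕⁻ G x := by
        -- The inverse transform is the Fourier integral of the pairing −⟨·, ·⟩, so the same duality
        -- applies.
        have hc : Continuous fun p : V × V => (-innerₗ V) p.1 p.2 := by
          exact (continuous_inner (𝕜 := ℝ) (E := V)).neg
        have := VectorFourier.integral_fourierIntegral_smul_eq_flip (L := -innerₗ V)
          Real.continuous_fourierChar hc (g.integrable (μ := volume)) hi
        have hflip : (-innerₗ V).flip = -innerₗ V := by
          ext x y; simp [real_inner_comm]
        rw [hflip] at this
        exact this

lemma memLp_fourierInv {G : V → ℂ} (hi : Integrable G) (h2 : MemLp G 2) : MemLp (𝓕⁻ G) 2 :=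
  (Lp.memLp _).ae_eq (coeFn_fourierInv_toLp hi h2)

lemma coeFn_fourier_toLp_fourierInv {G : V → ℂ} (hi : Integrable G) (h2 : MemLp G 2)
    (h : MemLp (𝓕⁻ G) 2) :
    (𝓕 (h.toLp (𝓕⁻ G)) : Lp ℂ 2 (volume : Measure V)) =ᵐ[volume] G := by
  have : h.toLp (𝓕⁻ G) = 𝓕⁻ (h2.toLp G) :=
    Lp.ext (h.coeFn_toLp.trans (coeFn_fourierInv_toLp hi h2).symm)
  rw [this, FourierTransform.fourier_fourierInv_eq]
  exact h2.coeFn_toLp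

lemma fourierInv_scale (g : V → ℂ) (x : V) :
    ∫ y : V, Complex.exp (Complex.I * ((inner ℝ x y : ℝ) : ℂ)) * g y =
      (((2 * Real.pi) ^ Module.finrank ℝ V : ℝ) : ℂ) * 𝓕⁻ (fun y => g ((2 * Real.pi) • y)) x := by
  have h := Measure.integral_comp_smul (volume : Measure V)
    (fun y => Complex.exp (Complex.I * ((inner ℝ x y : ℝ) : ℂ)) * g y) (2 * Real.pi)
  have hpos : (0 : ℝ) < (2 * Real.pi) ^ Module.finrank ℝ V := by positivity
  have hpos' := Complex.ofReal_ne_zero.mpr hpos.ne'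
  rw [abs_of_pos (by positivity), ← smul_right_injective _ hpos.ne' |>.eq_iff] at h
  simp only [smul_smul, mul_inv_cancel₀ hpos.ne', one_smul] at h
  rw [← h, Real.fourierInv_eq', Complex.real_smul]
  congr 2 with y
  rw [smul_eq_mul, inner_smul_right, real_inner_comm]
  congr 2
  push_cast; ring

end Plancherel

/-! ### Fourier inversion in the fibres -/

section Fibres

variable {n : ℕ}

lemma fourierConst_ne_zero (n : ℕ) : fourierConst n ≠ 0 := by
  rw [fourierConst, Complex.ofReal_ne_zero]; positivity

lemma fourierConst_mul_pow (e : USphere n) (hn : 2 ≤ n) : fourierConst n *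
    (((2 * Real.pi) ^ Module.finrank ℝ (perp (e : Euc n)) : ℝ) : ℂ) = (fourierConst n)⁻¹ := by
  have hc : ((n - 1 : ℕ) : ℝ) = (n : ℝ) - 1 := by push_cast [show 1 ≤ n by omega]; ring
  rw [finrank_perp, fourierConst, ← Complex.ofReal_mul, ← Complex.ofReal_inv,
    ← Real.rpow_natCast, ← Real.rpow_add (by positivity), ← Real.rpow_neg (by positivity), hc]
  congr 2; ring

/-- The Fourier transform in the fibres inverts the inverse Fourier transform on `L¹ ∩ L²`. -/
theorem fourierTS_fourierInv_ae (hn : 2 ≤ n) {φ Φ : TS n → ℂ} (ξ : USphere n)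
    (hi : Integrable (fibre Φ ξ)) (h2 : MemLp (fibre Φ ξ) 2)
    (hφ : ∀ x : perp (ξ : Euc n), φ (TS.mk ξ x) = fourierInvTS Φ (TS.mk ξ x)) :
    ∀ᵐ y : perp (ξ : Euc n), fourierTS φ (TS.mk ξ y) = Φ (TS.mk ξ y) := by
  have hc0 := fourierConst_ne_zero n
  -- The rescaling for which φ(·, ξ) is exactly `𝓕⁻ Ψ`, with kernel e^{2πi⟨w, x⟩}.
  set Ψ : perp (ξ : Euc n) → ℂ := fun w => (fourierConst n)⁻¹ * fibre Φ ξ ((2 * Real.pi) • w) with hΨ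
  have h2π : (2 * Real.pi : ℝ) ≠ 0 := by positivity
  have hΨi : Integrable Ψ := (hi.comp_smul h2π).const_mul _
  have hΨ2 : MemLp Ψ 2 := by
    refine MemLp.const_mul ?_ _
    have hmap := Measure.map_addHaar_smul (volume : Measure (perp (ξ : Euc n))) h2π
    refine MemLp.comp_of_map (g := fibre Φ ξ) (f := fun w => (2 * Real.pi) • w) ?_ (by fun_prop)
    rw [hmap]
    exact h2.smul_measure ENNReal.ofReal_ne_top
  have hfib : fibre φ ξ = 𝓕⁻ Ψ := by
    ext x
    change φ (TS.mk ξ x) = _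
    rw [hφ]
    change fourierConst n * ∫ y : perp (ξ : Euc n),
      Complex.exp (Complex.I * ((inner ℝ x y : ℝ) : ℂ)) * fibre Φ ξ y = _
    rw [fourierInv_scale, ← mul_assoc, fourierConst_mul_pow ξ hn, Real.fourierInv_eq,
      Real.fourierInv_eq, ← integral_const_mul]
    congr 1 with y
    simp only [hΨ, Circle.smul_def, smul_eq_mul]
    ring
  have hscale : ∀ {P : perp (ξ : Euc n) → Prop}, (∀ᵐ y, P y) → ∀ᵐ y, P ((2 * Real.pi)⁻¹ • y) :=
    fun h => (Measure.quasiMeasurePreserving_smul volume (inv_ne_zero h2π)).ae h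
  have hval : ∀ y, fourierConst n * Ψ ((2 * Real.pi)⁻¹ • y) = Φ (TS.mk ξ y) := by
    intro y
    simp only [hΨ, smul_smul, mul_inv_cancel₀ h2π, one_smul, mul_inv_cancel_left₀ hc0]
    rfl
  have hm : MemLp (fibre φ ξ) 2 := hfib ▸ memLp_fourierInv hΨi hΨ2
  have hL2 : (𝓕 (hm.toLp (fibre φ ξ)) : Lp ℂ 2 (volume : Measure (perp (ξ : Euc n))))
      =ᵐ[volume] Ψ := by
    have := coeFn_fourier_toLp_fourierInv hΨi hΨ2 (memLp_fourierInv hΨi hΨ2)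
    convert this
  -- Both branches of the definition of `fourierTS` can occur; in the integrable one the integral
  -- agrees almost everywhere with the L² transform.
  by_cases hint : Integrable (fibre φ ξ)
  · filter_upwards [hscale (coeFn_fourier_toLp hint hm), hscale hL2] with y h1 h2
    rw [fourierTS_mk, if_pos hint, ← fourier_scale, ← h1, h2, hval]
  · filter_upwards [hscale hL2] with y h2
    rw [fourierTS_mk, if_neg hint, dif_pos hm, h2, hval]

end Fibres

/-! ### Line integrals and their derivatives -/

section LineIntegrals

variable {n : ℕ} {F : Type*} [NormedAddCommGroup F] [NormedSpace ℝ F]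

/-- Decay of a Schwartz function along lines, locally uniformly in the line. -/
lemma exists_line_decay (v : 𝓢(Euc n, F)) (R : ℝ) (hR : 0 < R) : ∃ C : ℝ, ∀ x ξ : Euc n,
    ‖x‖ ≤ R → R⁻¹ ≤ ‖ξ‖ → ∀ t : ℝ, ‖v (x + t • ξ)‖ * (1 + |t|) ≤ C * (1 + t ^ 2)⁻¹ := by
  -- Decay of order 3: one power pays for 1 + |t|, produced by differentiating v(x + tξ) in ξ, and
  -- two leave the integrable (1 + t²)⁻¹.
  set S := 2 ^ 3 * ((Finset.Iic (3, 0)).sup fun m => SchwartzMap.seminorm ℝ m.1 m.2) v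
  refine ⟨(1 + R + R ^ 2) ^ 3 * S, fun x ξ hx hξ t => ?_⟩
  have h := SchwartzMap.one_add_le_sup_seminorm_apply (𝕜 := ℝ) (m := (3, 0)) le_rfl le_rfl v
    (x + t • ξ)
  rw [norm_iteratedFDeriv_zero] at h
  set z := x + t • ξ with hz
  have h1 : |t| * ‖ξ‖ ≤ ‖z‖ + R := by
    calc |t| * ‖ξ‖ = ‖z - x‖ := by rw [hz, add_sub_cancel_left, norm_smul, Real.norm_eq_abs]
      _ ≤ ‖z‖ + ‖x‖ := norm_sub_le _ _
      _ ≤ _ := by gcongr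
  have h2 : |t| ≤ R * (‖z‖ + R) := by
    have : |t| * R⁻¹ ≤ |t| * ‖ξ‖ := by gcongr
    calc |t| = R * (|t| * R⁻¹) := by field_simp
      _ ≤ _ := mul_le_mul_of_nonneg_left (this.trans h1) hR.le
  have h3 : 1 + |t| ≤ (1 + R + R ^ 2) * (1 + ‖z‖) := by
    nlinarith [norm_nonneg z, mul_nonneg (sq_nonneg R) (norm_nonneg z)]
  have h4 : (1 + |t|) ^ 3 * ‖v z‖ ≤ (1 + R + R ^ 2) ^ 3 * S :=
    calc (1 + |t|) ^ 3 * ‖v z‖ ≤ ((1 + R + R ^ 2) * (1 + ‖z‖)) ^ 3 * ‖v z‖ := by gcongr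
      _ = (1 + R + R ^ 2) ^ 3 * ((1 + ‖z‖) ^ 3 * ‖v z‖) := by ring
      _ ≤ _ := by gcongr
  rw [← div_eq_mul_inv, le_div_iff₀ (by positivity)]
  refine le_trans ?_ h4
  have h5 : 1 + t ^ 2 ≤ (1 + |t|) ^ 2 := by nlinarith [abs_nonneg t, sq_abs t]
  calc ‖v z‖ * (1 + |t|) * (1 + t ^ 2) ≤ ‖v z‖ * (1 + |t|) * (1 + |t|) ^ 2 := by gcongr
    _ = _ := by ring

lemma integrable_comp_line [CompleteSpace F] (v : 𝓢(Euc n, F)) (x : Euc n) {ξ : Euc n}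
    (hξ : ξ ≠ 0) : Integrable fun t : ℝ => v (x + t • ξ) := by
  have hξ' : 0 < ‖ξ‖ := norm_pos_iff.mpr hξ
  obtain ⟨C, hC⟩ := exists_line_decay v (‖x‖ + ‖ξ‖⁻¹) (by positivity)
  refine (integrable_inv_one_add_sq.const_mul C).mono'
    (by have := v.continuous; fun_prop : Continuous _).aestronglyMeasurable (.of_forall fun t => ?_)
  refine le_trans ?_ (hC x ξ (by linarith [inv_pos.mpr hξ']) ?_ t)
  · exact le_mul_of_one_le_right (norm_nonneg _) (by linarith [abs_nonneg t])
  · rw [inv_le_comm₀ (by positivity) hξ']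
    linarith [norm_nonneg x]

/-- The integral of a function over the line `x + ℝ ξ`. -/
def lineIntegral (u : Euc n → ℂ) (q : Euc n × Euc n) : ℂ := ∫ t : ℝ, u (q.1 + t • q.2)

lemma lineIntegral_add (u v : 𝓢(Euc n, ℂ)) {q : Euc n × Euc n} (hq : q.2 ≠ 0) :
    lineIntegral (u + v : 𝓢(Euc n, ℂ)) q = lineIntegral u q + lineIntegral v q :=
  integral_add (integrable_comp_line u q.1 hq) (integrable_comp_line v q.1 hq)

lemma lineIntegral_smul (c : ℂ) (u : 𝓢(Euc n, ℂ)) (q : Euc n × Euc n) :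
    lineIntegral (c • u : 𝓢(Euc n, ℂ)) q = c * lineIntegral u q :=
  integral_const_mul c _

lemma lineIntegral_sum {ι : Type*} (s : Finset ι) (u : ι → 𝓢(Euc n, ℂ)) {q : Euc n × Euc n}
    (hq : q.2 ≠ 0) :
    lineIntegral (∑ i ∈ s, u i : 𝓢(Euc n, ℂ)) q = ∑ i ∈ s, lineIntegral (u i) q := by
  have : ∀ x, (∑ i ∈ s, u i) x = ∑ i ∈ s, u i x := fun x => by simp
  simp only [lineIntegral, this]
  exact integral_finsetSum _ fun i _ => integrable_comp_line (u i) q.1 hq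

/-- The derivative of `(x, ξ) ↦ u (x + t ξ)`. -/
def lineFDeriv (u : 𝓢(Euc n, ℂ)) (q : Euc n × Euc n) (t : ℝ) : Euc n × Euc n →L[ℝ] ℂ :=
  (fderivCLM ℝ (Euc n) ℂ u (q.1 + t • q.2)).comp
    (ContinuousLinearMap.fst ℝ (Euc n) (Euc n) + t • ContinuousLinearMap.snd ℝ (Euc n) (Euc n))

lemma continuous_lineFDeriv (u : 𝓢(Euc n, ℂ)) (q : Euc n × Euc n) :
    Continuous (lineFDeriv u q) := by
  unfold lineFDeriv
  have := (fderivCLM ℝ (Euc n) ℂ u).continuous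
  fun_prop

lemma norm_lineFDeriv_le (u : 𝓢(Euc n, ℂ)) (q : Euc n × Euc n) (t : ℝ) :
    ‖lineFDeriv u q t‖ ≤ ‖fderivCLM ℝ (Euc n) ℂ u (q.1 + t • q.2)‖ * (1 + |t|) := by
  refine (ContinuousLinearMap.opNorm_comp_le _ _).trans ?_
  gcongr
  refine (norm_add_le _ _).trans ?_
  rw [norm_smul, Real.norm_eq_abs]
  exact add_le_add (ContinuousLinearMap.norm_fst_le ..)
    (mul_le_of_le_one_right (abs_nonneg t) (ContinuousLinearMap.norm_snd_le ..))

/-- Differentiation under the integral: near q the base point is bounded and the direction stays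
away from 0, so one integrable function of t dominates all derivatives. -/
lemma hasFDerivAt_lineIntegral (u : 𝓢(Euc n, ℂ)) {q : Euc n × Euc n} (hq : q.2 ≠ 0) :
    Integrable (lineFDeriv u q) ∧
      HasFDerivAt (lineIntegral u) (∫ t, lineFDeriv u q t) q := by
  have hξ' : 0 < ‖q.2‖ := norm_pos_iff.mpr hq
  set R := ‖q.1‖ + ‖q.2‖⁻¹ + 1 with hR
  have hR0 : 0 < R := by positivity
  obtain ⟨C, hC⟩ := exists_line_decay (fderivCLM ℝ (Euc n) ℂ u) R hR0
  set s : Set (Euc n × Euc n) := {p | ‖p.1‖ < R} ∩ {p | R⁻¹ < ‖p.2‖} with hs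
  have hso : IsOpen s := (isOpen_lt (by fun_prop) (by fun_prop)).inter
    (isOpen_lt (by fun_prop) (by fun_prop))
  have hqs : q ∈ s := by
    refine ⟨?_, ?_⟩
    · change ‖q.1‖ < R
      linarith [inv_pos.mpr hξ']
    · change R⁻¹ < ‖q.2‖
      rw [inv_lt_comm₀ hR0 hξ']
      linarith [norm_nonneg q.1]
  have hbound : ∀ t : ℝ, ∀ p ∈ s, ‖lineFDeriv u p t‖ ≤ C * (1 + t ^ 2)⁻¹ := fun t p hp =>
    (norm_lineFDeriv_le u p t).trans (hC p.1 p.2 (le_of_lt hp.1) (le_of_lt hp.2) t)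
  refine ⟨(integrable_inv_one_add_sq.const_mul C).mono'
    (continuous_lineFDeriv u q).aestronglyMeasurable (.of_forall fun t => hbound t q hqs), ?_⟩
  refine hasFDerivAt_integral_of_dominated_of_fderiv_le (s := s)
    (F := fun q t => u (q.1 + t • q.2)) (F' := lineFDeriv u)
    (bound := fun t => C * (1 + t ^ 2)⁻¹) (hso.mem_nhds hqs) ?_ (integrable_comp_line u q.1 hq)
    (continuous_lineFDeriv u q).aestronglyMeasurable (.of_forall hbound)
    (integrable_inv_one_add_sq.const_mul C) (.of_forall fun t p _ => ?_)
  · exact .of_forall fun p =>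
      (by have := u.continuous; fun_prop : Continuous _).aestronglyMeasurable
  · have h1 : HasFDerivAt (fun q : Euc n × Euc n => q.1 + t • q.2)
        (ContinuousLinearMap.fst ℝ (Euc n) (Euc n) +
          t • ContinuousLinearMap.snd ℝ (Euc n) (Euc n)) p :=
      hasFDerivAt_fst.add (hasFDerivAt_snd.const_smul t)
    exact (u.hasFDerivAt (p.1 + t • p.2)).comp p h1

end LineIntegrals

/-! ### Derivatives of the ray transform -/

section RayTransform

variable {n : ℕ}

open LineDeriv

/-- The `j`-th component of a vector field. -/
def component (f : SchwartzField n) (j : Fin n) : 𝓢(Euc n, ℂ) :=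
  f.postcompCLM (EuclideanSpace.proj j : EuclideanSpace ℂ (Fin n) →L[ℂ] ℂ)

@[simp] lemma component_apply (f : SchwartzField n) (j : Fin n) (x : Euc n) :
    component f j x = f x j := rfl

/-- The extension of `I⁰ f` to lines with arbitrary direction vectors. -/
def rayExt (f : SchwartzField n) (q : Euc n × Euc n) : ℂ :=
  ∑ j, lineIntegral (component f j) q * ((q.2 j : ℝ) : ℂ)

/-- The integrand `∑ⱼ ξⱼ fⱼ` of `I⁰ f`. -/
def dirSum (f : SchwartzField n) (ξ : Euc n) : 𝓢(Euc n, ℂ) :=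
  ∑ j, ((ξ j : ℝ) : ℂ) • component f j

lemma dirSum_apply (f : SchwartzField n) (ξ x : Euc n) :
    dirSum f ξ x = ∑ j, f x j * ((ξ j : ℝ) : ℂ) := by
  simp [dirSum, mul_comm]

lemma rayExt_eq (f : SchwartzField n) {q : Euc n × Euc n} (hq : q.2 ≠ 0) :
    rayExt f q = lineIntegral (dirSum f q.2) q := by
  rw [dirSum, lineIntegral_sum _ _ hq]
  simp_rw [lineIntegral_smul]
  exact Finset.sum_congr rfl fun j _ => mul_comm _ _

/-- The integral of ∑ ξⱼfⱼ over x + ℝξ is unchanged by shifting x along ξ and by positive rescaling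
of ξ. So the retraction can be removed by a substitution in t, and no derivative of it is needed. -/
lemma extTS_rayTransform_zero (f : SchwartzField n) {q : Euc n × Euc n} (hq : q.2 ≠ 0) :
    extTS (rayTransform 0 f) q = rayExt f q := by
  have h0 : ‖q.2‖ ≠ 0 := norm_ne_zero_iff.mpr hq
  rw [extTS, dif_pos hq, rayExt_eq f hq]
  set c := inner ℝ q.2 q.1 / ‖q.2‖ ^ 2
  set g : ℝ → ℂ := fun t => dirSum f q.2 (q.1 + t • q.2) with hg
  have h1 : rayTransform 0 f (TS.retract q hq) =
      ∫ t : ℝ, ((‖q.2‖⁻¹ : ℝ) : ℂ) * g (t * ‖q.2‖⁻¹ - c) := by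
    unfold rayTransform
    congr 1 with t
    rw [hg, pow_zero, one_mul]
    simp only [dirSum_apply]
    rw [Finset.mul_sum]
    refine Finset.sum_congr rfl fun j _ => ?_
    have : (TS.retract q hq).pt + t • ((TS.retract q hq).dir : Euc n) =
        q.1 + (t * ‖q.2‖⁻¹ - c) • q.2 := by
      change q.1 - c • q.2 + t • (‖q.2‖⁻¹ • q.2) = _
      rw [sub_smul, smul_smul]; abel
    rw [this]
    change _ * (((‖q.2‖⁻¹ • q.2) j : ℝ) : ℂ) = _
    simp
    ring
  rw [h1, integral_const_mul, Measure.integral_comp_mul_right (fun t => g (t - c)),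
    integral_sub_right_eq_self g c, lineIntegral, inv_inv, abs_of_nonneg (norm_nonneg _), Complex.real_smul,
    ← mul_assoc, ← Complex.ofReal_mul, inv_mul_cancel₀ h0, Complex.ofReal_one, one_mul]

lemma hasFDerivAt_rayExt (f : SchwartzField n) {q : Euc n × Euc n} (hq : q.2 ≠ 0) :
    HasFDerivAt (rayExt f) (∑ j, (lineIntegral (component f j) q •
      (Complex.ofRealCLM.comp ((EuclideanSpace.proj j : Euc n →L[ℝ] ℝ).comp
        (ContinuousLinearMap.snd ℝ (Euc n) (Euc n)))) +
      ((q.2 j : ℝ) : ℂ) • ∫ t, lineFDeriv (component f j) q t)) q := by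
  unfold rayExt
  refine HasFDerivAt.fun_sum fun j _ => ?_
  exact (hasFDerivAt_lineIntegral (component f j) hq).2.mul
    (Complex.ofRealCLM.comp ((EuclideanSpace.proj j : Euc n →L[ℝ] ℝ).comp
        (ContinuousLinearMap.snd ℝ (Euc n) (Euc n)))).hasFDerivAt

lemma eventually_snd_ne_zero {q : Euc n × Euc n} (hq : q.2 ≠ 0) :
    ∀ᶠ p : Euc n × Euc n in nhds q, p.2 ≠ 0 :=
  continuous_snd.continuousAt.eventually_ne hq

lemma hasFDerivAt_extTS_rayTransform (f : SchwartzField n) {q : Euc n × Euc n} (hq : q.2 ≠ 0) :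
    HasFDerivAt (extTS (rayTransform 0 f)) (∑ j, (lineIntegral (component f j) q •
      (Complex.ofRealCLM.comp ((EuclideanSpace.proj j : Euc n →L[ℝ] ℝ).comp
        (ContinuousLinearMap.snd ℝ (Euc n) (Euc n)))) +
      ((q.2 j : ℝ) : ℂ) • ∫ t, lineFDeriv (component f j) q t)) q :=
  (hasFDerivAt_rayExt f hq).congr_of_eventuallyEq
    ((eventually_snd_ne_zero hq).mono fun _ hp => extTS_rayTransform_zero f hp)

lemma TS.dir_ne_zero (p : TS n) : p.1.2 ≠ 0 := fun h => by simpa [h] using p.2.1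

theorem differentiableTS_rayTransform (f : SchwartzField n) :
    DifferentiableTS (rayTransform 0 f) :=
  fun p => (hasFDerivAt_extTS_rayTransform f p.dir_ne_zero).differentiableAt

/-- The Schwartz function whose integrals over the lines of direction `ξ` are `Ξᵢ (I⁰ f)`. -/
def xiField (f : SchwartzField n) (i : Fin n) (ξ : Euc n) : 𝓢(Euc n, ℂ) :=
  (∑ j, ((ξ j : ℝ) : ℂ) •
    (innerMul ξ (∂_{(EuclideanSpace.single i 1 : Euc n)} (component f j)) +
      (-1 : ℂ) • innerMul (EuclideanSpace.single i 1) (∂_{ξ} (component f j)))) +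
    (component f i + (-((ξ i : ℝ) : ℂ)) • dirSum f ξ)

/-- At z = x + tξ with x ⊥ ξ one has t = ⟨z, ξ⟩ and xᵢ + tξᵢ = zᵢ, so the differentiated integrand t
∂ᵢfⱼ − (xᵢ + tξᵢ) ∂_ξ fⱼ depends on z and ξ only. Differentiating the factor ξⱼ contributes δᵢⱼ −
ξᵢξⱼ. -/
theorem opXi_rayTransform_mk (f : SchwartzField n) (i : Fin n) (ξ : USphere n)
    (x : perp (ξ : Euc n)) :
    opXi i (rayTransform 0 f) (TS.mk ξ x) =
      ∫ t : ℝ, xiField f i ξ ((x : Euc n) + t • (ξ : Euc n)) := by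
  have hξ0 : (ξ : Euc n) ≠ 0 := fun h => by simpa [h] using ξ.2
  have hort : inner ℝ (x : Euc n) (ξ : Euc n) = 0 := by
    rw [real_inner_comm]; exact Submodule.mem_orthogonal_singleton_iff_inner_right.mp x.2
  have hp : (TS.mk ξ x).1 = ((x : Euc n), (ξ : Euc n)) := rfl
  have hu : ∀ u : 𝓢(Euc n, ℂ), Integrable fun t : ℝ => u ((x : Euc n) + t • (ξ : Euc n)) :=
    fun u => integrable_comp_line u x hξ0
  rw [opXi, hp, (hasFDerivAt_extTS_rayTransform f (q := ((x : Euc n), (ξ : Euc n))) hξ0).fderiv]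
  have hline : ∀ j, (∫ t, lineFDeriv (component f j) ((x : Euc n), (ξ : Euc n)) t)
      (xiVec i ((x : Euc n), (ξ : Euc n))) = lineIntegral
        (innerMul ξ (∂_{(EuclideanSpace.single i 1 : Euc n)} (component f j)) +
          (-1 : ℂ) • innerMul (EuclideanSpace.single i 1) (∂_{(ξ : Euc n)} (component f j)) :
          𝓢(Euc n, ℂ)) ((x : Euc n), (ξ : Euc n)) := by
    intro j
    rw [lineIntegral]
    rw [ContinuousLinearMap.integral_apply
      (hasFDerivAt_lineIntegral (component f j) (q := ((x : Euc n), (ξ : Euc n))) hξ0).1]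
    congr 1 with t
    have hinner : inner ℝ ((x : Euc n) + t • (ξ : Euc n)) (ξ : Euc n) = t := by
      rw [inner_add_left, hort, inner_smul_left, real_inner_self_eq_norm_sq]
      simp
    have hvec : ((ContinuousLinearMap.fst ℝ (Euc n) (Euc n) +
          t • ContinuousLinearMap.snd ℝ (Euc n) (Euc n)) (xiVec i ((x : Euc n), (ξ : Euc n)))) =
        t • EuclideanSpace.single i 1 - ((x : Euc n) i + t * (ξ : Euc n) i) • (ξ : Euc n) := by
      simp [xiVec, smul_sub, add_smul, mul_smul]
      abel
    rw [lineFDeriv, ContinuousLinearMap.comp_apply, hvec, map_sub, map_smul, map_smul]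
    simp only [add_apply, smul_apply, innerMul_apply, lineDerivOp_apply_eq_fderiv, hinner,
      fderivCLM_apply]
    simp [EuclideanSpace.inner_single_right]
    ring
  have hcoord : ∀ j, (Complex.ofRealCLM.comp ((EuclideanSpace.proj j : Euc n →L[ℝ] ℝ).comp
        (ContinuousLinearMap.snd ℝ (Euc n) (Euc n)))) (xiVec i ((x : Euc n), (ξ : Euc n))) =
      (if j = i then 1 else 0) - (((ξ : Euc n) i : ℝ) : ℂ) * (((ξ : Euc n) j : ℝ) : ℂ) := by
    intro j
    simp only [xiVec, ContinuousLinearMap.comp_apply, ContinuousLinearMap.coe_snd']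
    by_cases hji : j = i <;> simp [hji]
  change _ = lineIntegral (xiField f i ξ) ((x : Euc n), (ξ : Euc n))
  rw [xiField, lineIntegral_add _ _ hξ0, lineIntegral_add _ _ hξ0, lineIntegral_smul,
    lineIntegral_sum _ _ hξ0, dirSum, lineIntegral_sum _ _ hξ0]
  simp_rw [lineIntegral_smul]
  simp only [sum_apply, add_apply, smul_apply, hline, hcoord, smul_eq_mul]
  rw [Finset.sum_add_distrib, add_comm, Finset.mul_sum]
  congr 1
  simp_rw [mul_sub, Finset.sum_sub_distrib]
  simp only [mul_ite, mul_one, mul_zero, Finset.sum_ite_eq', Finset.mem_univ, if_true,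
    sub_eq_add_neg, ← Finset.sum_neg_distrib]
  congr 1
  refine Finset.sum_congr rfl fun j _ => ?_
  ring

end RayTransform

/-! ### Symbols of the transforms -/

section Symbols

variable {n : ℕ}

open LineDeriv

lemma schwartzFT_sum {ι : Type*} (s : Finset ι) (u : ι → 𝓢(Euc n, ℂ)) :
    schwartzFT (∑ i ∈ s, u i) = ∑ i ∈ s, schwartzFT (u i) :=
  map_sum (AddMonoidHom.mk' schwartzFT schwartzFT_add) u s

lemma inner_perp (ξ : USphere n) (y : perp (ξ : Euc n)) :
    inner ℝ (y : Euc n) (ξ : Euc n) = 0 := by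
  rw [real_inner_comm]; exact Submodule.mem_orthogonal_singleton_iff_inner_right.mp y.2

/-- The Fourier transform of the `j`-th component of a vector field. -/
def componentFT (f : SchwartzField n) (j : Fin n) : 𝓢(Euc n, ℂ) := schwartzFT (component f j)

/-- The function `∑ⱼ ξⱼ f̂ⱼ(y)`. -/
def symA (f : SchwartzField n) (q : Euc n × Euc n) : ℂ :=
  ∑ j, ((q.2 j : ℝ) : ℂ) * componentFT f j q.1

/-- The function `∑ⱼ ξⱼ ⟨ξ, ∇⟩ f̂ⱼ(y)`. -/
def symB (f : SchwartzField n) (q : Euc n × Euc n) : ℂ :=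
  ∑ j, ((q.2 j : ℝ) : ℂ) * fderiv ℝ (componentFT f j) q.1 q.2

/-- The function `Ξᵢ (∑ⱼ ξⱼ f̂ⱼ(y))`. -/
def symXi (f : SchwartzField n) (i : Fin n) (q : Euc n × Euc n) : ℂ :=
  componentFT f i q.1 - ((q.2 i : ℝ) : ℂ) * symA f q - ((q.1 i : ℝ) : ℂ) * symB f q

/-- The function `∑ᵢ (yᵢ / |y|) Ξᵢ (∑ⱼ ξⱼ f̂ⱼ(y))`. -/
def symZ (f : SchwartzField n) (q : Euc n × Euc n) : ℂ :=
  ∑ i, ((q.1 i / ‖q.1‖ : ℝ) : ℂ) * symXi f i q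

lemma schwartzFT_dirSum (f : SchwartzField n) (ξ : Euc n) :
    schwartzFT (dirSum f ξ) = ∑ j, ((ξ j : ℝ) : ℂ) • componentFT f j := by
  simp_rw [dirSum, schwartzFT_sum, schwartzFT_smul, componentFT]

lemma schwartzFT_dirSum_apply (f : SchwartzField n) (ξ y : Euc n) :
    schwartzFT (dirSum f ξ) y = symA f (y, ξ) := by
  simp [schwartzFT_dirSum, symA]

lemma fderiv_schwartzFT_dirSum (f : SchwartzField n) (ξ y : Euc n) :
    fderiv ℝ (schwartzFT (dirSum f ξ)) y ξ = symB f (y, ξ) := by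
  rw [schwartzFT_dirSum, ← fderivCLM_apply ℂ, map_sum]
  simp [symB]

lemma fderiv_schwartzFT_lineDeriv (u : 𝓢(Euc n, ℂ)) (m y v : Euc n) :
    fderiv ℝ (schwartzFT (∂_{m} u)) y v =
      Complex.I * ((inner ℝ v m : ℝ) * schwartzFT u y +
        (inner ℝ y m : ℝ) * fderiv ℝ (schwartzFT u) y v) := by
  have h1 : (schwartzFT (∂_{m} u) : Euc n → ℂ) =
      fun y => Complex.I * ((inner ℝ y m : ℝ) * schwartzFT u y) := by
    ext y; rw [schwartzFT_lineDeriv, mul_assoc]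
  have h2 : HasFDerivAt (fun y : Euc n => ((inner ℝ y m : ℝ) : ℂ))
      (Complex.ofRealCLM.comp ((innerSL ℝ).flip m)) y :=
    (Complex.ofRealCLM.comp ((innerSL ℝ).flip m)).hasFDerivAt
  have h3 : fderiv ℝ (fun y => Complex.I * ((inner ℝ y m : ℝ) * schwartzFT u y)) y = _ :=
    ((h2.mul ((schwartzFT u).hasFDerivAt y)).const_mul Complex.I).fderiv
  rw [h1, h3]
  simp only [smul_apply, add_apply, ContinuousLinearMap.comp_apply, ContinuousLinearMap.flip_apply,
    innerSL_apply_apply, Complex.ofRealCLM_apply, smul_eq_mul]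
  ring

/-- ⟨z, ξ⟩∂ᵢ becomes −(ξᵢ + yᵢ∂_ξ) and zᵢ∂_ξ becomes −(ξᵢ + ⟨y, ξ⟩∂ᵢ). On `ξ^⊥` the last term
vanishes, and the difference is −yᵢ∂_ξ. -/
lemma schwartzFT_xiField (f : SchwartzField n) (i : Fin n) (ξ : USphere n)
    (y : perp (ξ : Euc n)) :
    schwartzFT (xiField f i ξ) y = symXi f i ((y : Euc n), (ξ : Euc n)) := by
  have hterm : ∀ j, schwartzFT (innerMul ξ (∂_{(EuclideanSpace.single i 1 : Euc n)}
        (component f j)) + (-1 : ℂ) • innerMul (EuclideanSpace.single i 1)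
        (∂_{(ξ : Euc n)} (component f j))) y =
      -((((y : Euc n) i : ℝ) : ℂ) * fderiv ℝ (componentFT f j) y (ξ : Euc n)) := by
    intro j
    rw [schwartzFT_add, schwartzFT_smul, add_apply, smul_apply, schwartzFT_innerMul,
      schwartzFT_innerMul, fderiv_schwartzFT_lineDeriv, fderiv_schwartzFT_lineDeriv, inner_perp,
      real_inner_comm]
    simp only [EuclideanSpace.inner_single_right, componentFT]
    simp only [RCLike.conj_to_real, one_mul, smul_eq_mul, real_inner_comm]
    simp [EuclideanSpace.inner_single_right]
    linear_combination (((y : Euc n) i : ℝ) : ℂ) *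
      fderiv ℝ (schwartzFT (component f j)) y (ξ : Euc n) * Complex.I_mul_I
  rw [xiField, schwartzFT_add, schwartzFT_add, schwartzFT_sum, schwartzFT_smul]
  simp_rw [schwartzFT_smul]
  simp only [add_apply, smul_apply, sum_apply, hterm, schwartzFT_dirSum_apply]
  have : symB f ((y : Euc n), (ξ : Euc n)) * (((y : Euc n) i : ℝ) : ℂ) =
      ∑ j, (((ξ : Euc n) j : ℝ) : ℂ) * ((((y : Euc n) i : ℝ) : ℂ) *
        fderiv ℝ (componentFT f j) y (ξ : Euc n)) := by
    rw [symB, Finset.sum_mul]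
    exact Finset.sum_congr rfl fun j _ => by ring
  simp only [symXi, smul_eq_mul, mul_neg, Finset.sum_neg_distrib, ← this]
  rw [← componentFT]
  ring

lemma rayTransform_zero_mk (f : SchwartzField n) (ξ : USphere n) (x : perp (ξ : Euc n)) :
    rayTransform 0 f (TS.mk ξ x) = ∫ t : ℝ, dirSum f ξ ((x : Euc n) + t • (ξ : Euc n)) := by
  unfold rayTransform
  congr 1 with t
  rw [pow_zero, one_mul, dirSum_apply]
  rfl

lemma rayTransform_one_mk (f : SchwartzField n) (ξ : USphere n) (x : perp (ξ : Euc n)) :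
    rayTransform 1 f (TS.mk ξ x) =
      ∫ t : ℝ, innerMul ξ (dirSum f ξ) ((x : Euc n) + t • (ξ : Euc n)) := by
  unfold rayTransform
  congr 1 with t
  have hinner : inner ℝ ((x : Euc n) + t • (ξ : Euc n)) (ξ : Euc n) = t := by
    rw [inner_add_left, inner_perp, inner_smul_left, real_inner_self_eq_norm_sq]
    simp
  rw [pow_one, innerMul_apply, hinner, dirSum_apply]
  rfl

theorem fourierTS_rayTransform_zero (f : SchwartzField n) (ξ : USphere n)
    (y : perp (ξ : Euc n)) : fourierTS (rayTransform 0 f) (TS.mk ξ y) =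
      (Real.sqrt (2 * Real.pi) : ℂ) * symA f ((y : Euc n), (ξ : Euc n)) := by
  rw [fourierTS_eq_of_fibre_eq_line (dirSum f ξ).integrable (rayTransform_zero_mk f ξ),
    ← schwartzFT_apply, schwartzFT_dirSum_apply]

theorem fourierTS_rayTransform_one (f : SchwartzField n) (ξ : USphere n)
    (y : perp (ξ : Euc n)) : fourierTS (rayTransform 1 f) (TS.mk ξ y) =
      (Real.sqrt (2 * Real.pi) : ℂ) * (Complex.I * symB f ((y : Euc n), (ξ : Euc n))) := by
  have hi : Integrable (innerMul ξ (dirSum f ξ) : Euc n → ℂ) :=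
    (innerMul (ξ : Euc n) (dirSum f ξ)).integrable
  have h := rayTransform_one_mk f ξ
  rw [fourierTS_eq_of_fibre_eq_line hi h, ← schwartzFT_apply, schwartzFT_innerMul,
    fderiv_schwartzFT_dirSum]

theorem fourierTS_opXi_rayTransform (f : SchwartzField n) (i : Fin n) (ξ : USphere n)
    (y : perp (ξ : Euc n)) : fourierTS (opXi i (rayTransform 0 f)) (TS.mk ξ y) =
      (Real.sqrt (2 * Real.pi) : ℂ) * symXi f i ((y : Euc n), (ξ : Euc n)) := by
  have hi : Integrable (xiField f i ξ : Euc n → ℂ) := (xiField f i (ξ : Euc n)).integrable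
  have h := opXi_rayTransform_mk f i ξ
  rw [fourierTS_eq_of_fibre_eq_line hi h, ← schwartzFT_apply, schwartzFT_xiField]

lemma TS.mk_dir_vec (p : TS n) : TS.mk p.dir p.vec = p := rfl

lemma fourierTS_rayTransform_eq (f : SchwartzField n) (p : TS n) :
    fourierTS (rayTransform 0 f) p = (Real.sqrt (2 * Real.pi) : ℂ) * symA f p.1 := by
  conv_lhs => rw [← p.mk_dir_vec]
  exact fourierTS_rayTransform_zero f p.dir p.vec

lemma extTS_fourierTS_rayTransform (f : SchwartzField n) {q : Euc n × Euc n} (hq : q.2 ≠ 0) :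
    extTS (fourierTS (rayTransform 0 f)) q = (Real.sqrt (2 * Real.pi) : ℂ) *
      symA f (q.1 - (inner ℝ q.2 q.1 / ‖q.2‖ ^ 2) • q.2, ‖q.2‖⁻¹ • q.2) := by
  rw [extTS, dif_pos hq, fourierTS_rayTransform_eq]
  rfl

lemma hasFDerivAt_symA (f : SchwartzField n) (q : Euc n × Euc n) :
    HasFDerivAt (symA f) (∑ j, (((q.2 j : ℝ) : ℂ) • (fderiv ℝ (componentFT f j) q.1).comp
        (ContinuousLinearMap.fst ℝ (Euc n) (Euc n)) +
      componentFT f j q.1 • (Complex.ofRealCLM.comp ((EuclideanSpace.proj j : Euc n →L[ℝ] ℝ).comp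
        (ContinuousLinearMap.snd ℝ (Euc n) (Euc n)))))) q := by
  unfold symA
  refine HasFDerivAt.fun_sum fun j _ => ?_
  exact (Complex.ofRealCLM.comp ((EuclideanSpace.proj j : Euc n →L[ℝ] ℝ).comp
        (ContinuousLinearMap.snd ℝ (Euc n) (Euc n)))).hasFDerivAt.mul
    (((componentFT f j).hasFDerivAt q.1).comp q hasFDerivAt_fst)

lemma fderiv_symA_xiVec (f : SchwartzField n) (i : Fin n) (q : Euc n × Euc n) :
    fderiv ℝ (symA f) q (xiVec i q) = symXi f i q := by
  rw [(hasFDerivAt_symA f q).fderiv]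
  have hcoord : ∀ j, (Complex.ofRealCLM.comp ((EuclideanSpace.proj j : Euc n →L[ℝ] ℝ).comp
        (ContinuousLinearMap.snd ℝ (Euc n) (Euc n)))) (xiVec i q) =
      (if j = i then 1 else 0) - ((q.2 i : ℝ) : ℂ) * ((q.2 j : ℝ) : ℂ) := by
    intro j
    simp only [xiVec, ContinuousLinearMap.comp_apply, ContinuousLinearMap.coe_snd']
    by_cases hji : j = i <;> simp [hji]
  simp only [sum_apply, add_apply, smul_apply, hcoord, smul_eq_mul]
  simp only [xiVec, ContinuousLinearMap.comp_apply, ContinuousLinearMap.coe_fst', map_neg,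
    map_smul, Complex.real_smul, mul_sub, Finset.sum_add_distrib, Finset.sum_sub_distrib, mul_ite,
    mul_one, mul_zero, Finset.sum_ite_eq', Finset.mem_univ, if_true, symXi, symA, symB,
    Finset.mul_sum, mul_neg, Finset.sum_neg_distrib]
  rw [neg_add_eq_sub]
  congr 1
  · congr 1
    exact Finset.sum_congr rfl fun j _ => by ring
  · exact Finset.sum_congr rfl fun j _ => by ring

theorem differentiableTS_fourierTS_rayTransform (f : SchwartzField n) :
    DifferentiableTS (fourierTS (rayTransform 0 f)) := by
  intro p
  have hp := p.dir_ne_zero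
  have hr : DifferentiableAt ℝ (fun q : Euc n × Euc n =>
      (q.1 - (inner ℝ q.2 q.1 / ‖q.2‖ ^ 2) • q.2, ‖q.2‖⁻¹ • q.2)) p.1 := by
    have h1 : DifferentiableAt ℝ (fun q : Euc n × Euc n => ‖q.2‖) p.1 :=
      DifferentiableAt.norm ℝ differentiableAt_snd hp
    have h0 : ‖p.1.2‖ ≠ 0 := norm_ne_zero_iff.mpr hp
    have h2 : DifferentiableAt ℝ (fun q : Euc n × Euc n => inner ℝ q.2 q.1) p.1 :=
      differentiableAt_snd.inner ℝ differentiableAt_fst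
    have h4 : DifferentiableAt ℝ (fun q : Euc n × Euc n => ‖q.2‖ ^ 2) p.1 := h1.pow 2
    have h3 : DifferentiableAt ℝ (fun q : Euc n × Euc n => inner ℝ q.2 q.1 / ‖q.2‖ ^ 2) p.1 :=
      by simpa only [div_eq_mul_inv] using h2.fun_mul (h4.fun_inv (pow_ne_zero 2 h0))
    exact (differentiableAt_fst.sub (h3.smul differentiableAt_snd)).prodMk
      ((h1.inv h0).smul differentiableAt_snd)
  have := ((hasFDerivAt_symA f _).differentiableAt.comp p.1 hr).const_mul
    (Real.sqrt (2 * Real.pi) : ℂ)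
  exact this.congr_of_eventuallyEq
    ((eventually_snd_ne_zero hp).mono fun q hq => extTS_fourierTS_rayTransform f hq)

lemma symA_smul (f : SchwartzField n) (r : ℝ) (y ξ : Euc n) :
    symA f (y, r • ξ) = (r : ℂ) * symA f (y, ξ) := by
  simp only [symA, Finset.mul_sum]
  exact Finset.sum_congr rfl fun j _ => by simp; ring

/-- `symA` is homogeneous of degree 1 in ξ, so it is not the extension by retraction. The two are
compared along the line through p in the direction (v, w) of Ξᵢ: its two components stay orthogonal,
so the retraction merely divides the direction by √(1 + s²|w|²), which is stationary at s = 0. -/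
theorem opXi_fourierTS_rayTransform (f : SchwartzField n) (i : Fin n) (p : TS n) :
    opXi i (fourierTS (rayTransform 0 f)) p =
      (Real.sqrt (2 * Real.pi) : ℂ) * symXi f i p.1 := by
  obtain ⟨⟨y, ξ⟩, hξ, hy⟩ := p
  simp only at hξ hy
  set v : Euc n := -(y i • ξ) with hv
  set w : Euc n := EuclideanSpace.single i 1 - ξ i • ξ with hw
  have hxi : xiVec i (y, ξ) = (v, w) := rfl
  have hξξ : inner ℝ ξ ξ = 1 := by rw [real_inner_self_eq_norm_sq, hξ, one_pow]
  have hξw : inner ℝ ξ w = 0 := by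
    rw [hw, inner_sub_right, inner_smul_right, hξξ]
    simp [EuclideanSpace.inner_single_right]
  have hyw : inner ℝ w y = y i := by
    rw [hw, inner_sub_left, inner_smul_left, real_inner_comm y ξ, hy]
    simp [EuclideanSpace.inner_single_left]
  have hnorm : ∀ s : ℝ, ‖ξ + s • w‖ ^ 2 = 1 + s ^ 2 * ‖w‖ ^ 2 := by
    intro s
    rw [norm_add_sq_real, hξ, inner_smul_right, hξw, norm_smul, mul_pow, Real.norm_eq_abs, sq_abs]
    ring
  have hne : ∀ s : ℝ, ξ + s • w ≠ 0 := by
    intro s h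
    have := hnorm s
    rw [h, norm_zero] at this
    nlinarith [mul_nonneg (sq_nonneg s) (sq_nonneg ‖w‖)]
  have hort : ∀ s : ℝ, inner ℝ (ξ + s • w) (y + s • v) = 0 := by
    intro s
    simp only [hv, smul_neg, inner_add_left, inner_add_right, inner_neg_right, inner_smul_left,
      inner_smul_right, hyw, hξξ, real_inner_comm ξ w, hξw, real_inner_comm y ξ, hy]
    simp
  have hν : ∀ s : ℝ, ‖ξ + s • w‖⁻¹ = (Real.sqrt (1 + s ^ 2 * ‖w‖ ^ 2))⁻¹ := by
    intro s; rw [← hnorm, Real.sqrt_sq (norm_nonneg _)]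
  have hcurve : (fun s : ℝ => extTS (fourierTS (rayTransform 0 f)) ((y, ξ) + s • (v, w))) =
      fun s => (Real.sqrt (2 * Real.pi) : ℂ) * ((((Real.sqrt (1 + s ^ 2 * ‖w‖ ^ 2))⁻¹ : ℝ) : ℂ) *
        symA f ((y, ξ) + s • (v, w))) := by
    ext s
    rw [extTS_fourierTS_rayTransform f (q := (y, ξ) + s • (v, w)) (hne s)]
    simp only [Prod.smul_mk, Prod.mk_add_mk, hort, zero_div, zero_smul, sub_zero, symA_smul, hν]
  have hcurve0 : HasDerivAt (fun s : ℝ => (y, ξ) + s • (v, w)) (v, w) 0 := by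
    simpa using ((hasDerivAt_id (0 : ℝ)).smul_const (v, w)).const_add (y, ξ)
  have hν0 : HasDerivAt (fun s : ℝ => (((Real.sqrt (1 + s ^ 2 * ‖w‖ ^ 2))⁻¹ : ℝ) : ℂ)) 0 0 := by
    have h1 : HasDerivAt (fun s : ℝ => 1 + s ^ 2 * ‖w‖ ^ 2) 0 0 := by
      simpa using (((hasDerivAt_id (0 : ℝ)).pow 2).mul_const (‖w‖ ^ 2)).const_add 1
    have h2 := (h1.sqrt (by simp)).inv (by simp)
    simpa using h2.ofReal_comp
  have hA : HasDerivAt (fun s : ℝ => symA f ((y, ξ) + s • (v, w))) (symXi f i (y, ξ)) 0 := by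
    have h := (hasFDerivAt_symA f ((y, ξ) + (0 : ℝ) • (v, w))).differentiableAt.hasFDerivAt.comp_hasDerivAt
      (0 : ℝ) hcurve0
    rw [zero_smul, add_zero, ← hxi, fderiv_symA_xiVec] at h
    exact h
  have hdiff := differentiableTS_fourierTS_rayTransform f ⟨(y, ξ), hξ, hy⟩
  have h1 : HasDerivAt (fun s : ℝ => extTS (fourierTS (rayTransform 0 f)) ((y, ξ) + s • (v, w)))
      (fderiv ℝ (extTS (fourierTS (rayTransform 0 f))) (y, ξ) (v, w)) 0 := by
    have hd : HasFDerivAt (extTS (fourierTS (rayTransform 0 f)))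
        (fderiv ℝ (extTS (fourierTS (rayTransform 0 f))) (y, ξ)) ((y, ξ) + (0 : ℝ) • (v, w)) := by
      rw [zero_smul, add_zero]; exact hdiff.hasFDerivAt
    exact hd.comp_hasDerivAt (0 : ℝ) hcurve0
  rw [hcurve] at h1
  have h2 := h1.unique ((hν0.mul hA).const_mul (Real.sqrt (2 * Real.pi) : ℂ))
  refine Eq.trans (b := fderiv ℝ (extTS (fourierTS (rayTransform 0 f))) (y, ξ) (v, w)) rfl
    (h2.trans ?_)
  simp

lemma zSymbol_rayTransform (f : SchwartzField n) (p : TS n) :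
    zSymbol (rayTransform 0 f) p = (Real.sqrt (2 * Real.pi) : ℂ) * symZ f p.1 := by
  simp only [zSymbol, symZ, opXi_fourierTS_rayTransform, Finset.mul_sum]
  exact Finset.sum_congr rfl fun i _ => mul_left_comm _ _ _

end Symbols

/-! ### Decay of the symbols and the transform of Z(I⁰f) -/

section SymbolDecay

variable {n : ℕ}

open LineDeriv

lemma fderiv_eq_sum_lineDeriv (u : 𝓢(Euc n, ℂ)) (y v : Euc n) :
    fderiv ℝ u y v = ∑ p, ((v p : ℝ) : ℂ) * (∂_{(EuclideanSpace.single p 1 : Euc n)} u) y := by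
  have hv : v = ∑ p, v p • (EuclideanSpace.single p 1 : Euc n) := by
    simpa using ((EuclideanSpace.basisFun (Fin n) ℝ).sum_repr v).symm
  conv_lhs => rw [hv, map_sum]
  simp [lineDerivOp_apply_eq_fderiv]

/-- Partial derivatives are again Schwartz functions, so in this form decay and measurability follow
from the closure rules. -/
lemma symB_eq (f : SchwartzField n) : symB f = fun q => ∑ j, ((q.2 j : ℝ) : ℂ) *
    ∑ p, ((q.2 p : ℝ) : ℂ) *
      (∂_{(EuclideanSpace.single p 1 : Euc n)} (componentFT f j)) q.1 := by
  ext q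
  simp only [symB, fderiv_eq_sum_lineDeriv]

lemma rapidDecay_symA (f : SchwartzField n) : RapidDecay (symA f) :=
  RapidDecay.sum _ fun j _ => (RapidDecay.of_schwartz (componentFT f j)).dir_mul j

lemma rapidDecay_symB (f : SchwartzField n) : RapidDecay (symB f) := by
  rw [symB_eq]
  exact RapidDecay.sum _ fun j _ =>
    (RapidDecay.sum _ fun p _ => (RapidDecay.of_schwartz _).dir_mul p).dir_mul j

lemma rapidDecay_symXi (f : SchwartzField n) (i : Fin n) : RapidDecay (symXi f i) :=
  ((RapidDecay.of_schwartz (componentFT f i)).sub ((rapidDecay_symA f).dir_mul i)).sub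
    ((rapidDecay_symB f).pt_mul i)

lemma rapidDecay_symZ (f : SchwartzField n) : RapidDecay (symZ f) :=
  RapidDecay.sum _ fun i _ => (rapidDecay_symXi f i).unit_mul i

lemma measurable_schwartz_fst (u : 𝓢(Euc n, ℂ)) :
    Measurable fun q : Euc n × Euc n => u q.1 :=
  u.continuous.measurable.comp measurable_fst

@[fun_prop]
lemma measurable_symA (f : SchwartzField n) : Measurable (symA f) := by
  have := fun j => measurable_schwartz_fst (componentFT f j)
  unfold symA; fun_prop

@[fun_prop]
lemma measurable_symB (f : SchwartzField n) : Measurable (symB f) := by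
  have := fun j p => measurable_schwartz_fst
    (∂_{(EuclideanSpace.single p 1 : Euc n)} (componentFT f j))
  rw [symB_eq]; fun_prop

@[fun_prop]
lemma measurable_symXi (f : SchwartzField n) (i : Fin n) : Measurable (symXi f i) := by
  have := measurable_schwartz_fst (componentFT f i)
  unfold symXi; fun_prop

@[fun_prop]
lemma measurable_symZ (f : SchwartzField n) : Measurable (symZ f) := by
  unfold symZ; fun_prop

lemma RapidDecay.integrable_fibre (hn : 2 ≤ n) {g : Euc n × Euc n → ℂ} (hg : RapidDecay g)
    (hm : Measurable g) (ξ : USphere n) :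
    Integrable (fun y : perp (ξ : Euc n) => g ((y : Euc n), (ξ : Euc n))) := by
  have := nontrivial_perp hn ξ
  have hd : 0 < Module.finrank ℝ (perp (ξ : Euc n)) := Module.finrank_pos
  have hd' : (0 : ℝ) < Module.finrank ℝ (perp (ξ : Euc n)) := by exact_mod_cast hd
  obtain ⟨C, hC⟩ := hg.norm_le (Module.finrank ℝ (perp (ξ : Euc n)))
  refine ((integrable_norm_rpow_mul (V := perp (ξ : Euc n)) (a := 0)
    (b := -(Module.finrank ℝ (perp (ξ : Euc n)) : ℝ)) (by linarith) (by linarith)).const_mul C).mono'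
    (by fun_prop : Measurable _).aestronglyMeasurable (.of_forall fun y => ?_)
  simpa using hC y ξ (by simp)

lemma RapidDecay.memLp_fibre (hn : 2 ≤ n) {g : Euc n × Euc n → ℂ} (hg : RapidDecay g)
    (hm : Measurable g) (ξ : USphere n) :
    MemLp (fun y : perp (ξ : Euc n) => g ((y : Euc n), (ξ : Euc n))) 2 := by
  have := nontrivial_perp hn ξ
  have hd : 0 < Module.finrank ℝ (perp (ξ : Euc n)) := Module.finrank_pos
  have hd' : (0 : ℝ) < Module.finrank ℝ (perp (ξ : Euc n)) := by exact_mod_cast hd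
  have hms : Measurable fun y : perp (ξ : Euc n) => g ((y : Euc n), (ξ : Euc n)) := by fun_prop
  rw [memLp_two_iff_integrable_sq_norm hms.aestronglyMeasurable]
  obtain ⟨C, b, hb, hC⟩ := exists_weight_mul_le hg hg 0 0 (Module.finrank ℝ (perp (ξ : Euc n)))
  refine ((integrable_norm_rpow_mul (V := perp (ξ : Euc n)) (a := 2 * 0) (b := b) (by linarith)
    hb).const_mul C).mono' (by fun_prop : Measurable _).aestronglyMeasurable (.of_forall fun y => ?_)
  have := hC y ξ (by simp)
  simpa [weight, pow_two] using this

/-- The symbol is in L¹ ∩ L² of each fibre, so L² inversion applies. The case c = 1 is the defining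
relation of Z, and c = i serves the scalar product. -/
theorem fourierTS_opZ_ae (hn : 2 ≤ n) (f : SchwartzField n) (c : ℂ) (ξ : USphere n) :
    ∀ᵐ y : perp (ξ : Euc n), fourierTS (fun p => c * opZ (rayTransform 0 f) p) (TS.mk ξ y) =
      c * zSymbol (rayTransform 0 f) (TS.mk ξ y) := by
  have hfib : fibre (fun p => c * zSymbol (rayTransform 0 f) p) ξ =
      fun y : perp (ξ : Euc n) => (fun q => (c * (Real.sqrt (2 * Real.pi) : ℂ)) * symZ f q)
        ((y : Euc n), (ξ : Euc n)) := by
    ext y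
    simp only [fibre, zSymbol_rayTransform, mul_assoc]
    rfl
  have hdec := (rapidDecay_symZ f).const_mul (c * (Real.sqrt (2 * Real.pi) : ℂ))
  refine fourierTS_fourierInv_ae (Φ := fun p => c * zSymbol (rayTransform 0 f) p) hn ξ ?_ ?_ ?_
  · rw [hfib]
    exact hdec.integrable_fibre hn (by fun_prop) ξ
  · rw [hfib]
    exact hdec.memLp_fibre hn (by fun_prop) ξ
  · intro x
    simp only [opZ, fourierInvTS, fibre]
    rw [mul_left_comm, ← integral_const_mul]
    congr 2 with y
    ring

end SymbolDecay

/-! ### Scalar products in terms of symbols -/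

section ScalarProducts

variable {n : ℕ}

lemma sqrt_two_pi_mul_conj :
    (Real.sqrt (2 * Real.pi) : ℂ) * conj (Real.sqrt (2 * Real.pi) : ℂ) = ((2 * Real.pi : ℝ) : ℂ) := by
  rw [Complex.conj_ofReal, ← Complex.ofReal_mul, Real.mul_self_sqrt (by positivity)]

/-- The values of `g` are, up to the factor `√(2π)`, the Fourier transform of `φ` in the fibres. -/
def HasSymbol (φ : TS n → ℂ) (g : Euc n × Euc n → ℂ) : Prop :=
  ∀ ξ : USphere n, ∀ᵐ y : perp (ξ : Euc n),
    fourierTS φ (TS.mk ξ y) = (Real.sqrt (2 * Real.pi) : ℂ) * g ((y : Euc n), (ξ : Euc n))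

/-- The integrand of the scalar product in terms of symbols. -/
def symIntegrand (s t : ℝ) (g h : Euc n × Euc n → ℂ) (q : Euc n × Euc n) : ℂ :=
  ((weight s t q.1 : ℝ) : ℂ) * (g q * conj (h q))

variable {φ ψ : TS n → ℂ} {g h : Euc n × Euc n → ℂ}

lemma HasSymbol.innerIntegrand_ae (hφ : HasSymbol φ g) (hψ : HasSymbol ψ h) (s t : ℝ)
    (ξ : USphere n) : ∀ᵐ y : perp (ξ : Euc n),
      ((2 * Real.pi : ℝ) : ℂ) * symIntegrand s t g h (TS.mk ξ y).1 =
        innerIntegrand s t φ ψ (TS.mk ξ y) := by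
  filter_upwards [hφ ξ, hψ ξ] with y h1 h2
  rw [innerIntegrand, h1, h2, map_mul, ← sqrt_two_pi_mul_conj]
  simp only [symIntegrand, TS.mk, TS.pt]
  ring

/-- A point of `T𝕊ⁿ⁻¹` in the coordinates given by the reflections `e^⊥ → ξ^⊥`. -/
def tsPoint (e : USphere n) (p : USphere n × perp (e : Euc n)) : Euc n × Euc n :=
  ((perpIso e p.1 p.2 : Euc n), (p.1 : Euc n))

lemma integrable_symIntegrand (hn : 2 ≤ n) (e : USphere n) (hgm : Measurable g)
    (hhm : Measurable h) (hg : RapidDecay g) (hh : RapidDecay h) (s : ℝ) {t : ℝ}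
    (ht : -((n : ℝ) - 1) < 2 * t) :
    Integrable (fun p => symIntegrand s t g h (tsPoint e p)) (tsMeasure e) :=
  integrable_weight_mul hn e hgm hhm hg hh s ht

theorem HasSymbol.finiteInnerTS (hn : 2 ≤ n) (e : USphere n) (hφ : HasSymbol φ g)
    (hψ : HasSymbol ψ h) (hgm : Measurable g) (hhm : Measurable h) (hg : RapidDecay g)
    (hh : RapidDecay h) (s : ℝ) {t : ℝ} (ht : -((n : ℝ) - 1) < 2 * t) :
    FiniteInnerTS s t φ ψ :=
  (integrableTS_of_integrable e (G := fun p => ((2 * Real.pi : ℝ) : ℂ) * symIntegrand s t g h p.1)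
    ((integrable_symIntegrand hn e hgm hhm hg hh s ht).const_mul _)).congr
    (hφ.innerIntegrand_ae hψ s t)

theorem HasSymbol.innerTS_eq (hn : 2 ≤ n) (e : USphere n) (hφ : HasSymbol φ g)
    (hψ : HasSymbol ψ h) (hgm : Measurable g) (hhm : Measurable h) (hg : RapidDecay g)
    (hh : RapidDecay h) (s : ℝ) {t : ℝ} (ht : -((n : ℝ) - 1) < 2 * t) :
    innerTS s t φ ψ = ∫ p, symIntegrand s t g h (tsPoint e p) ∂tsMeasure e := by
  have h0 := (integrable_symIntegrand hn e hgm hhm hg hh s ht).const_mul ((2 * Real.pi : ℝ) : ℂ)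
  have h2π : (2 * Real.pi : ℝ) ≠ 0 := by positivity
  rw [innerTS, ← integralTS_congr
      (G := fun p => ((2 * Real.pi : ℝ) : ℂ) * symIntegrand s t g h p.1)
      (hφ.innerIntegrand_ae hψ s t), integralTS,
    iterated_integral_eq e
      (G := fun p => ((2 * Real.pi : ℝ) : ℂ) * symIntegrand s t g h p.1) h0,
    integral_const_mul, ← mul_assoc, ← Complex.ofReal_mul, inv_mul_cancel₀ h2π, Complex.ofReal_one,
    one_mul]
  rfl

lemma ofReal_normSqTS (s t : ℝ) (φ : TS n → ℂ) :
    ((normSqTS s t φ : ℝ) : ℂ) = innerTS s t φ φ := by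
  rw [normSqTS, innerTS, integralTS, Complex.ofReal_mul, ← integral_complex_ofReal]
  congr 2 with ξ
  rw [← integral_complex_ofReal]
  congr 1 with y
  rw [innerIntegrand, Complex.mul_conj, Complex.normSq_eq_norm_sq]
  push_cast
  rfl

end ScalarProducts

/-! ### The pointwise identity and the Reshetnyak formula -/

section Reshetnyak

variable {n : ℕ}

/-- With v = F − ax − by, both v and y are orthogonal to the unit vector x, so |F|² = |a|² + |v +
by|². The cross term is 2 Re(⟨v, y⟩ b̄) with ⟨v, y⟩ = rz. -/
lemma symbol_identity {ι : Type*} [Fintype ι] (F : ι → ℂ) (x y : ι → ℝ) (a b z : ℂ) (r : ℝ)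
    (hr : r ≠ 0) (ha : a = ∑ j, (x j : ℂ) * F j) (hx : ∑ j, x j ^ 2 = 1)
    (hy : ∑ j, y j ^ 2 = r ^ 2) (hxy : ∑ j, x j * y j = 0)
    (hz : z = ∑ j, ((y j / r : ℝ) : ℂ) * (F j - (x j : ℂ) * a - (y j : ℂ) * b)) :
    (∑ j, (F j - (x j : ℂ) * a - (y j : ℂ) * b) *
        conj (F j - (x j : ℂ) * a - (y j : ℂ) * b)) + a * conj a +
      (r : ℂ) ^ 2 * (b * conj b) + (r : ℂ) * (z * conj b + conj (z * conj b)) =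
      ∑ j, F j * conj (F j) := by
  have hr' : (r : ℂ) ≠ 0 := Complex.ofReal_ne_zero.mpr hr
  have hx' : ∑ j, (x j : ℂ) ^ 2 = 1 := by exact_mod_cast congrArg Complex.ofReal hx
  have hy' : ∑ j, (y j : ℂ) ^ 2 = (r : ℂ) ^ 2 := by exact_mod_cast congrArg Complex.ofReal hy
  have hxy' : ∑ j, (x j : ℂ) * (y j : ℂ) = 0 := by exact_mod_cast congrArg Complex.ofReal hxy
  set Y : ℂ := ∑ j, (y j : ℂ) * F j with hY
  have hz' : (r : ℂ) * z = Y - (r : ℂ) ^ 2 * b := by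
    have : ∀ j, (r : ℂ) * (((y j / r : ℝ) : ℂ) * (F j - (x j : ℂ) * a - (y j : ℂ) * b)) =
        (y j : ℂ) * F j - a * ((x j : ℂ) * (y j : ℂ)) - b * (y j : ℂ) ^ 2 := by
      intro j; push_cast; field_simp
    rw [hz, Finset.mul_sum]
    simp_rw [this, Finset.sum_sub_distrib, ← Finset.mul_sum]
    rw [hxy', hy', hY]; ring
  have hzc : (r : ℂ) * conj z = conj Y - (r : ℂ) ^ 2 * conj b := by
    have := congrArg conj hz'
    simpa using this
  have hac : conj a = ∑ j, (x j : ℂ) * conj (F j) := by simp [ha]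
  have hYc : conj Y = ∑ j, (y j : ℂ) * conj (F j) := by simp [hY]
  have hterm : ∀ j, (F j - (x j : ℂ) * a - (y j : ℂ) * b) *
      conj (F j - (x j : ℂ) * a - (y j : ℂ) * b) =
      F j * conj (F j) - conj a * ((x j : ℂ) * F j) - a * ((x j : ℂ) * conj (F j)) -
        conj b * ((y j : ℂ) * F j) - b * ((y j : ℂ) * conj (F j)) + (a * conj a) * (x j : ℂ) ^ 2 +
        (b * conj b) * (y j : ℂ) ^ 2 + (a * conj b + b * conj a) * ((x j : ℂ) * (y j : ℂ)) := by
    intro j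
    simp only [map_sub, map_mul, Complex.conj_ofReal]
    ring
  simp_rw [hterm, Finset.sum_add_distrib, Finset.sum_sub_distrib, ← Finset.mul_sum]
  rw [← ha, ← hac, ← hY, ← hYc, hx', hy', hxy']
  simp only [map_mul, Complex.conj_conj]
  linear_combination conj b * hz' + b * hzc

lemma weight_mul_norm (s t k : ℝ) {y : Euc n} (hy : y ≠ 0) :
    weight (s + k) (t + k) y = ‖y‖ ^ (2 * k) * weight s t y := by
  have : 0 < ‖y‖ := norm_pos_iff.mpr hy
  rw [weight, weight, show 2 * (t + k) = 2 * k + 2 * t by ring, Real.rpow_add this,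
    show s + k - (t + k) = s - t by ring, mul_assoc]

/-- The pointwise form of the Reshetnyak formula. -/
lemma symIntegrand_identity (f : SchwartzField n) (s t : ℝ) {y ξ : Euc n} (hy : y ≠ 0)
    (hξ : ‖ξ‖ = 1) (hort : inner ℝ y ξ = 0) :
    (∑ i, symIntegrand (s + 1 / 2) (t + 1 / 2) (symXi f i) (symXi f i) (y, ξ)) +
      symIntegrand (s + 1 / 2) (t + 1 / 2) (symA f) (symA f) (y, ξ) +
      symIntegrand (s + 3 / 2) (t + 3 / 2) (fun q => Complex.I * symB f q)
        (fun q => Complex.I * symB f q) (y, ξ) +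
      (symIntegrand (s + 1) (t + 1) (fun q => Complex.I * symZ f q)
        (fun q => Complex.I * symB f q) (y, ξ) +
        conj (symIntegrand (s + 1) (t + 1) (fun q => Complex.I * symZ f q)
        (fun q => Complex.I * symB f q) (y, ξ))) =
      ((‖y‖ * ∑ j, weight s t y * ‖componentFT f j y‖ ^ 2 : ℝ) : ℂ) := by
  have hr : ‖y‖ ≠ 0 := norm_ne_zero_iff.mpr hy
  have hx : ∑ j, ξ j ^ 2 = 1 := by rw [← EuclideanSpace.real_norm_sq_eq, hξ, one_pow]
  have hy2 : ∑ j, y j ^ 2 = ‖y‖ ^ 2 := (EuclideanSpace.real_norm_sq_eq y).symm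
  have hxy : ∑ j, ξ j * y j = 0 := by
    rw [← hort]; simp [PiLp.inner_apply]
  have hid := symbol_identity (fun j => componentFT f j y) ξ y (symA f (y, ξ)) (symB f (y, ξ))
    (symZ f (y, ξ)) ‖y‖ hr rfl hx hy2 hxy rfl
  -- Equal shifts of s and t only change the power of |y|. After one common |y| is taken out, the
  -- remaining factors 1, |y| and |y|² are those of `symbol_identity`.
  have h1 : weight (s + 1 / 2) (t + 1 / 2) y = ‖y‖ * weight s t y := by
    rw [weight_mul_norm s t _ hy]; norm_num
  have h2 : weight (s + 1) (t + 1) y = ‖y‖ ^ 2 * weight s t y := by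
    rw [weight_mul_norm s t _ hy, mul_one, Real.rpow_two]
  have h3 : weight (s + 3 / 2) (t + 3 / 2) y = ‖y‖ ^ 3 * weight s t y := by
    rw [weight_mul_norm s t _ hy, show (2 : ℝ) * (3 / 2) = (3 : ℕ) by norm_num, Real.rpow_natCast]
  have hrhs : ((‖y‖ * ∑ j, weight s t y * ‖componentFT f j y‖ ^ 2 : ℝ) : ℂ) =
      (‖y‖ : ℂ) * (weight s t y : ℂ) *
        ∑ j, componentFT f j y * conj (componentFT f j y) := by
    simp_rw [Complex.mul_conj, Complex.normSq_eq_norm_sq]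
    rw [← Finset.mul_sum]
    push_cast
    ring
  rw [hrhs, ← hid]
  simp only [symIntegrand, h1, h2, h3, symXi, map_mul, Complex.conj_I, Complex.conj_ofReal,
    Complex.conj_conj, Complex.ofReal_mul, Complex.ofReal_pow, map_neg, map_pow, ← Finset.mul_sum]
  -- The factors i on b and z cancel in pairs, since i · conj i = 1.
  linear_combination (-((‖y‖ : ℂ) ^ 3 * (weight s t y : ℂ) * (symB f (y, ξ) * conj (symB f (y, ξ)))
    + (‖y‖ : ℂ) ^ 2 * (weight s t y : ℂ) * (symZ f (y, ξ) * conj (symB f (y, ξ)) +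
      conj (symZ f (y, ξ)) * symB f (y, ξ)))) * Complex.I_mul_I

theorem mainTheorem4 (n : ℕ) (hn : 2 ≤ n) (s t : ℝ) (ht : -((n : ℝ) / 2) < t)
    (f : SchwartzField n) :
    -- the operators `Ξᵢ` are applied to differentiable functions
    (DifferentiableTS (rayTransform 0 f) ∧ DifferentiableTS (fourierTS (rayTransform 0 f))) ∧
    -- `Z (I⁰ f)` has the prescribed Fourier transform
    (∀ ξ : USphere n, ∀ᵐ y : perp (ξ : Euc n),
      fourierTS (opZ (rayTransform 0 f)) (TS.mk ξ y) =
        ∑ i, (((y : Euc n) i / ‖(y : Euc n)‖ : ℝ) : ℂ) *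
          opXi i (fourierTS (rayTransform 0 f)) (TS.mk ξ y)) ∧
    -- all norms and scalar products in the formula are finite
    (∀ i, FiniteNormRn s t (fun x => f x i)) ∧
    (∀ i, FiniteNormTS (s + 1 / 2) (t + 1 / 2) (opXi i (rayTransform 0 f))) ∧
    FiniteNormTS (s + 1 / 2) (t + 1 / 2) (rayTransform 0 f) ∧
    FiniteNormTS (s + 3 / 2) (t + 3 / 2) (rayTransform 1 f) ∧
    FiniteInnerTS (s + 1) (t + 1) (fun p => Complex.I * opZ (rayTransform 0 f) p)
      (rayTransform 1 f) ∧
    -- the Reshetnyak formula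
    normSqField s t f =
      reshConst n *
        ((∑ i, normSqTS (s + 1 / 2) (t + 1 / 2) (opXi i (rayTransform 0 f))) +
          normSqTS (s + 1 / 2) (t + 1 / 2) (rayTransform 0 f) +
          normSqTS (s + 3 / 2) (t + 3 / 2) (rayTransform 1 f) +
          2 * (innerTS (s + 1) (t + 1) (fun p => Complex.I * opZ (rayTransform 0 f) p)
            (rayTransform 1 f)).re) := by
  have hnt : Nontrivial (Euc n) := Module.nontrivial_of_finrank_pos (R := ℝ) (by simp; omega)
  obtain ⟨v, hv⟩ := exists_norm_eq (Euc n) zero_le_one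
  let e : USphere n := ⟨v, by simpa using hv⟩
  have hXi : ∀ i, HasSymbol (opXi i (rayTransform 0 f)) (symXi f i) :=
    fun i ξ => .of_forall fun y => fourierTS_opXi_rayTransform f i ξ y
  have hA : HasSymbol (rayTransform 0 f) (symA f) :=
    fun ξ => .of_forall fun y => fourierTS_rayTransform_zero f ξ y
  have hB : HasSymbol (rayTransform 1 f) (fun q => Complex.I * symB f q) :=
    fun ξ => .of_forall fun y => fourierTS_rayTransform_one f ξ y
  have hZ : HasSymbol (fun p => Complex.I * opZ (rayTransform 0 f) p)
      (fun q => Complex.I * symZ f q) := by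
    intro ξ
    filter_upwards [fourierTS_opZ_ae hn f Complex.I ξ] with y hy
    rw [hy, zSymbol_rayTransform, mul_left_comm]
    rfl
  have dB := (rapidDecay_symB f).const_mul Complex.I
  have dZ := (rapidDecay_symZ f).const_mul Complex.I
  have mB : Measurable fun q => Complex.I * symB f q := by fun_prop
  have mZ : Measurable fun q => Complex.I * symZ f q := by fun_prop
  -- On the (n − 1)-dimensional fibres this is integrability of the weight at 0, and it is
  -- equivalent to t > −n/2.
  have ht1 : -((n : ℝ) - 1) < 2 * (t + 1 / 2) := by linarith
  have ht2 : -((n : ℝ) - 1) < 2 * (t + 1) := by linarith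
  have ht3 : -((n : ℝ) - 1) < 2 * (t + 3 / 2) := by linarith
  have hRn : ∀ i, (fun y : Euc n => weight s t y * ‖fourierRn (fun x => f x i) y‖ ^ 2) =
      fun y => weight s t y * ‖componentFT f i y‖ ^ 2 := by
    intro i; ext y
    rw [componentFT, schwartzFT_apply]
    rfl
  have iRn : ∀ i, Integrable fun y : Euc n => weight s t y * ‖componentFT f i y‖ ^ 2 :=
    fun i => integrable_weight_mul_Rn hn (componentFT f i) s ht
  refine ⟨⟨differentiableTS_rayTransform f, differentiableTS_fourierTS_rayTransform f⟩,
    fun ξ => ?_, fun i => ?_, fun i => ?_, ?_, ?_, ?_, ?_⟩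
  · refine (fourierTS_opZ_ae hn f 1 ξ).mono fun y hy => ?_
    simp only [one_mul] at hy
    exact hy
  · rw [FiniteNormRn, hRn]
    exact iRn i
  · exact (hXi i).finiteInnerTS hn e (hXi i) (by fun_prop) (by fun_prop) (rapidDecay_symXi f i)
      (rapidDecay_symXi f i) _ ht1
  · exact hA.finiteInnerTS hn e hA (by fun_prop) (by fun_prop) (rapidDecay_symA f)
      (rapidDecay_symA f) _ ht1
  · exact hB.finiteInnerTS hn e hB mB mB dB dB _ ht3
  · exact hZ.finiteInnerTS hn e hB mZ mB dZ dB _ ht2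
  have kXi := fun i => integrable_symIntegrand hn e (measurable_symXi f i) (measurable_symXi f i)
    (rapidDecay_symXi f i) (rapidDecay_symXi f i) (s + 1 / 2) ht1
  have kA := integrable_symIntegrand hn e (measurable_symA f) (measurable_symA f)
    (rapidDecay_symA f) (rapidDecay_symA f) (s + 1 / 2) ht1
  have kB := integrable_symIntegrand hn e mB mB dB dB (s + 3 / 2) ht3
  have kZ := integrable_symIntegrand hn e mZ mB dZ dB (s + 1) ht2
  have kZc : Integrable (fun p => conj (symIntegrand (s + 1) (t + 1) (fun q => Complex.I * symZ f q)
      (fun q => Complex.I * symB f q) (tsPoint e p))) (tsMeasure e) :=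
    Complex.conjCLE.integrable_comp_iff.mpr kZ
  have kS := integrable_finsetSum Finset.univ fun i _ => kXi i
  have kSA := kS.fun_add kA
  have kSAB := kSA.fun_add kB
  have kZZ := kZ.fun_add kZc
  have hc : reshConst n ≠ 0 := (reshConst_pos hn).ne'
  have hne : ∀ᵐ p ∂tsMeasure e, p.2 ≠ 0 := by
    have := nontrivial_perp hn e
    exact Measure.quasiMeasurePreserving_snd.ae (p := fun x : perp (e : Euc n) => x ≠ 0)
      (by simp [ae_iff])
  -- The factor |y| cancels the density |y|⁻¹ that comes from integrating over hyperplanes.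
  set g : Euc n → ℝ := fun y => ‖y‖ * ∑ j, weight s t y * ‖componentFT f j y‖ ^ 2 with hg
  have hgm : Measurable g := by
    have := fun j => (componentFT f j).continuous.measurable
    fun_prop
  have hleft : normSqField s t f = reshConst n * ∫ p, g (perpIso e p.1 p.2) ∂tsMeasure e := by
    rw [integral_tsMeasure_eq hn e hgm, mul_inv_cancel_left₀ hc, normSqField]
    simp only [normSqRn, hRn]
    rw [← integral_finsetSum _ fun i _ => iRn i]
    refine integral_congr_ae ?_
    have : ∀ᵐ y : Euc n, y ≠ 0 := by simp [ae_iff]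
    filter_upwards [this] with y hy
    rw [hg, inv_mul_cancel_left₀ (norm_ne_zero_iff.mpr hy)]
  rw [hleft]
  congr 1
  rw [← Complex.ofReal_inj, ← integral_complex_ofReal]
  push_cast
  have hre : ∀ w : ℂ, 2 * (w.re : ℂ) = w + conj w := fun w => by
    rw [Complex.add_conj]; push_cast; rfl
  rw [hre]
  simp only [ofReal_normSqTS]
  rw [hA.innerTS_eq hn e hA (by fun_prop) (by fun_prop) (rapidDecay_symA f)
      (rapidDecay_symA f) _ ht1, hB.innerTS_eq hn e hB mB mB dB dB _ ht3,
    hZ.innerTS_eq hn e hB mZ mB dZ dB _ ht2, ← integral_conj,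
    Finset.sum_congr rfl fun i _ => (hXi i).innerTS_eq hn e (hXi i) (by fun_prop) (by fun_prop)
      (rapidDecay_symXi f i) (rapidDecay_symXi f i) _ ht1,
    ← integral_finsetSum _ fun i _ => kXi i, ← integral_add kZ kZc,
    ← integral_add kS kA, ← integral_add kSA kB, ← integral_add kSAB kZZ]
  refine integral_congr_ae ?_
  filter_upwards [hne] with p hp
  have hp' : (perpIso e p.1 p.2 : Euc n) ≠ 0 := by
    rw [← norm_ne_zero_iff, norm_perpIso]
    simpa using hp
  exact (symIntegrand_identity f s t hp' (by simp) (inner_perp p.1 (perpIso e p.1 p.2))).symm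

end Reshetnyak

end
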